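/- Let $\mathcal H$ be a complex Hilbert space (inner product $\langle\cdot,\cdot\rangle$ antilinear in its first argument) and let $\mathscr S(\mathcal H)$ be the class of closed symmetric operators $A$ in $\mathcal H$, not necessarily densely defined, which are regular (for every $z\in\mathbb C$ there is $d_z>0$ with $\|(A-zI)\psi\|\ge d_z\|\psi\|$ on $\operatorname{dom}(A)$) and have deficiency indices $(1,1)$, i.e. $\dim\ker(A^*\mp iI)=1$, where $A^*=\{(\eta,\omega):\langle\eta,A\varphi\rangle=\langle\omega,\varphi\rangle\ \forall\varphi\in\operatorname{dom}(A)\}$ is the adjoint linear relation and $\ker(A^*-zI)=\{\eta:(\eta,z\eta)\in A^*\}$. A canonical selfadjoint extension of $A$ is a linear relation $B=B^*$ in $\mathcal H$ containing the graph of $A$; its spectrum $\operatorname{Sp}(B)$ is the complement of the set of $z$ for which $(B-zI)^{-1}$ is a bounded operator defined on all of $\mathcal H$. An involution $J$ (antilinear, isometric, $J^2=I$) commutes with $B$ if $J(B-zI)^{-1}=(B-\bar zI)^{-1}J$ for all $z\in\mathbb C\setminus\mathbb R$. **Proposition.** Let $A\in\mathscr S(\mathcal H)$. (a) $A$ has canonical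 selfadjoint extensions, and there are involutions $J$ commuting with all of them. For every such $J$ and every canonical selfadjoint extension $B$ there are $v\in\mathbb R\setminus\operatorname{Sp}(B)$, $\psi\in\ker(A^*-vI)\setminus\{0\}$ with $J\psi=\psi$, and an entire function $h$ with $h(\bar z)=\overline{h(z)}$ whose zeros are simple and are exactly the points of $\operatorname{Sp}(B)$. For all such $J,B,v,\psi,h$ there is exactly one entire function $\xi:\mathbb C\to\mathcal H$ with $$\xi(z)=h(z)\left[I+(z-v)(B-zI)^{-1}\right]\psi,\qquad z\notin\operatorname{Sp}(B),$$ and it satisfies, for all $z\in\mathbb C$, $$\xi(z)\ne0,\qquad \xi(z)\in\ker(A^*-zI),\qquad J\xi(z)=\xi(\bar z).\tag{$*$}$$ (b) Let $J$ be an involution commuting with all canonical selfadjoint extensions of $A$ and let $\xi:\mathbb C\to\mathcal H$ be any entire function satisfying $(*)$. Then the map $\Phi$, $(\Phi\varphi)(z)=\langle\xi(\bar z),\varphi\rangle$, is injective on $\mathcal H$. Let $\widehat{\mathcal H}=\{\Phi\varphi:\varphi\in\mathcal H\}$ with the inner product $\langle\Phi\eta,\Phi\varphi\rangle:=\langle\eta,\varphi\rangle$.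 Then $\widehat{\mathcal H}$ is a de Branges space, i.e. a nontrivial Hilbert space of entire functions such that - (A1) for every $w\in\mathbb C\setminus\mathbb R$ the functional $f\mapsto f(w)$ is continuous; - (A2) if $f$ belongs to the space and $f(w)=0$ with $w\in\mathbb C\setminus\mathbb R$, then the function $f(z)(z-\bar w)(z-w)^{-1}$ belongs to the space and has the same norm as $f$; - (A3) if $f$ belongs to the space, then so does $f^\#(z)=\overline{f(\bar z)}$, with the same norm. Moreover $k(z,w)=\langle\xi(\bar z),\xi(\bar w)\rangle$ is its reproducing kernel: for every $w\in\mathbb C$, $k(\cdot,w)\in\widehat{\mathcal H}$ and $\langle k(\cdot,w),f\rangle=f(w)$ for all $f\in\widehat{\mathcal H}$. The unitary map $\Phi:\mathcal H\to\widehat{\mathcal H}$ satisfies $\Phi A\Phi^{-1}=S$ (with $\operatorname{dom}(S)=\Phi\operatorname{dom}(A)$), where $S$ is multiplication by $z$ in $\widehat{\mathcal H}$ with $\operatorname{dom}(S)=\{f\in\widehat{\mathcal H}: zf(z)\in\widehat{\mathcal H}\}$. (c) Hence every $A\in\mathscr S(\mathcal H)$ is unitarily equivalent to the operator of multiplication by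 $z$, with domain $\{f\in\mathcal B: zf(z)\in\mathcal B\}$, in some de Branges space $\mathcal B$. -/

import Mathlib

open scoped ComplexConjugate

-- `inner ℂ` is read through the `InnerProductSpace` structure, not through `CStarModule`
attribute [local instance 2000] InnerProductSpace.toInner

noncomputable section

namespace DeBrangesModel

section Relations

variable {H : Type*} [NormedAddCommGroup H] [InnerProductSpace ℂ H]

/-- The kernel of `T - zI` for a linear relation `T` in `H`: all `η` with `(η, zη) ∈ T`. -/
def relKer (T : Submodule ℂ (H × H)) (z : ℂ) : Submodule ℂ H :=
  T.comap (LinearMap.id.prod (z • LinearMap.id))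

/-- The bounded operator `R`, defined on all of `H`, is the inverse relation of `T - zI`, that is,
its graph is `{(ω - zη, η) : (η, ω) ∈ T}`. -/
def IsResolventAt (T : Submodule ℂ (H × H)) (z : ℂ) (R : H →L[ℂ] H) : Prop :=
  ∀ u η : H, (η, u + z • η) ∈ T ↔ R u = η

/-- The spectrum of a linear relation: the complement of the set of all `z` for which
`(T - zI)⁻¹` is a bounded operator defined on all of `H`. -/
def relSpectrum (T : Submodule ℂ (H × H)) : Set ℂ :=
  {z | ¬ ∃ R : H →L[ℂ] H, IsResolventAt T z R}

open Classical in
/-- The resolvent `(T - zI)⁻¹` for `z` outside the spectrum of `T` (and `0` on the spectrum). -/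
def relResolvent (T : Submodule ℂ (H × H)) (z : ℂ) : H →L[ℂ] H :=
  if h : ∃ R : H →L[ℂ] H, IsResolventAt T z R then h.choose else 0

/-- The class `𝒮(H)`: regular, closed, symmetric operators with deficiency indices `(1,1)`, whose
domain need not be dense. The adjoint is the linear relation `A.graph.adjoint`. -/
structure IsClassS (A : H →ₗ.[ℂ] H) : Prop where
  closed : A.IsClosed
  symmetric : ∀ x y : A.domain, inner ℂ (A x) (y : H) = inner ℂ (x : H) (A y)
  regular : ∀ z : ℂ, ∃ d : ℝ, 0 < d ∧ ∀ x : A.domain, d * ‖(x : H)‖ ≤ ‖A x - z • (x : H)‖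
  deficiency_upper : Module.finrank ℂ (relKer A.graph.adjoint Complex.I) = 1
  deficiency_lower : Module.finrank ℂ (relKer A.graph.adjoint (-Complex.I)) = 1

/-- `B` is a canonical selfadjoint extension of `A`: a selfadjoint linear relation in the same
space `H` that contains the graph of `A`. -/
def IsCanonicalExtension (A : H →ₗ.[ℂ] H) (B : Submodule ℂ (H × H)) : Prop :=
  A.graph ≤ B ∧ B.adjoint = B

/-- `J` is an involution (antilinear, isometric, `J² = I`) that commutes with all canonical
selfadjoint extensions `B` of `A`: `J (B - zI)⁻¹ = (B - z̄I)⁻¹ J` for all non-real `z`. -/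
structure IsCommutingInvolution (A : H →ₗ.[ℂ] H) (J : H →ₗᵢ⋆[ℂ] H) : Prop where
  involutive : ∀ φ, J (J φ) = φ
  commutes : ∀ B : Submodule ℂ (H × H), IsCanonicalExtension A B → ∀ z : ℂ, z.im ≠ 0 →
    ∀ φ, J (relResolvent B z φ) = relResolvent B (conj z) (J φ)

/-- The data from which the function `ξ` is built: a canonical selfadjoint extension `B`, a real
point `v` outside the spectrum of `B`, a nonzero `J`-real vector `ψ` in `Ker (A* - vI)`, and a real
entire function `h` whose zeros are simple and are exactly the points of the spectrum of `B`. -/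
structure IsModelData (A : H →ₗ.[ℂ] H) (J : H →ₗᵢ⋆[ℂ] H) (B : Submodule ℂ (H × H))
    (v : ℝ) (ψ : H) (h : ℂ → ℂ) : Prop where
  extension : IsCanonicalExtension A B
  point : (v : ℂ) ∉ relSpectrum B
  mem_ker : ψ ∈ relKer A.graph.adjoint (v : ℂ)
  ne_zero : ψ ≠ 0
  real_vector : J ψ = ψ
  entire : Differentiable ℂ h
  real_entire : ∀ z, h (conj z) = conj (h z)
  zeros : ∀ z, h z = 0 ↔ z ∈ relSpectrum B
  simple_zeros : ∀ z, h z = 0 → deriv h z ≠ 0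

/-- `ξ` is the entire function `ξ(z) = h(z) [I + (z - v)(B - zI)⁻¹] ψ`; on the spectrum of `B` its
values are those of the entire extension. -/
structure IsModelFunction (B : Submodule ℂ (H × H)) (v : ℝ) (ψ : H) (h : ℂ → ℂ) (ξ : ℂ → H) :
    Prop where
  entire : Differentiable ℂ ξ
  formula : ∀ z, z ∉ relSpectrum B → ξ z = h z • (ψ + (z - (v : ℂ)) • relResolvent B z ψ)

/-- `ξ` is a zero-free entire function with `ξ(z) ∈ Ker (A* - zI)` and `Jξ(z) = ξ(z̄)`. -/
structure IsKernelFunction (A : H →ₗ.[ℂ] H) (J : H →ₗᵢ⋆[ℂ] H) (ξ : ℂ → H) : Prop where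
  entire : Differentiable ℂ ξ
  zero_free : ∀ z, ξ z ≠ 0
  mem_ker : ∀ z, ξ z ∈ relKer A.graph.adjoint z
  real : ∀ z, J (ξ z) = ξ (conj z)

/-- The map `Φ`, `(Φφ)(z) = ⟨ξ(z̄), φ⟩` (the inner product is antilinear in its first argument). -/
def modelMap (ξ : ℂ → H) : H →ₗ[ℂ] (ℂ → ℂ) where
  toFun φ := fun z => inner ℂ (ξ (conj z)) φ
  map_add' φ η := by
    funext z
    exact inner_add_right _ _ _
  map_smul' c φ := by
    funext z
    exact inner_smul_right _ _ _

end Relations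

/-- A complex Hilbert space whose elements are functions `ℂ → ℂ`, with the pointwise operations. -/
structure FunctionHilbertSpace where
  carrier : Submodule ℂ (ℂ → ℂ)
  core : InnerProductSpace.Core ℂ carrier
  complete : @CompleteSpace carrier core.toNormedAddCommGroup.toMetricSpace.toUniformSpace

namespace FunctionHilbertSpace

/-- The type of elements of `𝓑`; it carries the norm and topology given by the inner product. -/
def Elem (𝓑 : FunctionHilbertSpace) : Type := 𝓑.carrier

instance (𝓑 : FunctionHilbertSpace) : NormedAddCommGroup 𝓑.Elem := 𝓑.core.toNormedAddCommGroup

instance (𝓑 : FunctionHilbertSpace) : InnerProductSpace ℂ 𝓑.Elem :=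
  @InnerProductSpace.ofCore ℂ 𝓑.carrier _ _ _ 𝓑.core.toCore

instance (𝓑 : FunctionHilbertSpace) : CompleteSpace 𝓑.Elem := 𝓑.complete

/-- The function that an element of `𝓑` is. -/
def Elem.fn {𝓑 : FunctionHilbertSpace} (f : 𝓑.Elem) : ℂ → ℂ := Subtype.val (p := (· ∈ 𝓑.carrier)) f

/-- `𝓑` is a de Branges space: a nontrivial Hilbert space of entire functions that satisfies the
axioms (A1), (A2), (A3). -/
structure IsDeBranges (𝓑 : FunctionHilbertSpace) : Prop where
  nontrivial : Nontrivial 𝓑.Elem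
  entire : ∀ f : 𝓑.Elem, Differentiable ℂ f.fn
  continuous_eval : ∀ w : ℂ, w.im ≠ 0 → Continuous fun f : 𝓑.Elem => f.fn w
  blaschke : ∀ (f : 𝓑.Elem) (w : ℂ), w.im ≠ 0 → f.fn w = 0 →
    ∃ g : 𝓑.Elem, (∀ z, z ≠ w → g.fn z = f.fn z * ((z - conj w) / (z - w))) ∧ ‖g‖ = ‖f‖
  sharp : ∀ f : 𝓑.Elem, ∃ g : 𝓑.Elem, (∀ z, g.fn z = conj (f.fn (conj z))) ∧ ‖g‖ = ‖f‖

/-- The operator `S` of multiplication by the independent variable in `𝓑`, with the domain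
`{f ∈ 𝓑 : z f(z) ∈ 𝓑}`. -/
def mulOperator (𝓑 : FunctionHilbertSpace) : 𝓑.Elem →ₗ.[ℂ] 𝓑.Elem where
  domain :=
    { carrier := {f | (fun z => z * f.fn z) ∈ 𝓑.carrier}
      add_mem' := by
        intro f g hf hg
        have h := 𝓑.carrier.add_mem hf hg
        have e : (fun z => z * (f + g).fn z) = (fun z => z * f.fn z) + fun z => z * g.fn z := by
          funext z
          exact mul_add z (f.fn z) (g.fn z)
        exact Set.mem_ofPred.2 (by rw [e]; exact h)
      zero_mem' := by
        have e : (fun z => z * (0 : 𝓑.Elem).fn z) = 0 := by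
          funext z
          exact mul_zero z
        exact Set.mem_ofPred.2 (by rw [e]; exact 𝓑.carrier.zero_mem)
      smul_mem' := by
        intro c f hf
        have h := 𝓑.carrier.smul_mem c hf
        have e : (fun z => z * (c • f).fn z) = c • fun z => z * f.fn z := by
          funext z
          exact mul_left_comm z c (f.fn z)
        exact Set.mem_ofPred.2 (by rw [e]; exact h) }
  toFun :=
    { toFun := fun f => (⟨fun z => z * f.1.fn z, f.2⟩ : 𝓑.carrier)
      map_add' := by
        intro f g
        refine Subtype.ext ?_
        funext z
        exact mul_add z (f.1.fn z) (g.1.fn z)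
      map_smul' := by
        intro c f
        refine Subtype.ext ?_
        funext z
        exact mul_left_comm z c (f.1.fn z) }

end FunctionHilbertSpace

section Image

variable {H : Type*} [NormedAddCommGroup H] [InnerProductSpace ℂ H]

/-- The inner product transported from `H` to the range of an injective linear map `Φ`. -/
abbrev imageCore (Φ : H →ₗ[ℂ] (ℂ → ℂ)) (hΦ : Function.Injective Φ) :
    InnerProductSpace.Core ℂ (LinearMap.range Φ) where
  inner f g :=
    inner ℂ ((LinearEquiv.ofInjective Φ hΦ).symm f) ((LinearEquiv.ofInjective Φ hΦ).symm g)
  conj_inner_symm f g := inner_conj_symm _ _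
  re_inner_nonneg f := inner_self_nonneg
  add_left f g k := by rw [map_add, inner_add_left]
  smul_left f g r := by rw [map_smul, inner_smul_left]
  definite f hf := by
    rw [inner_self_eq_zero] at hf
    exact (LinearEquiv.map_eq_zero_iff _).1 hf

theorem imageCore_norm (Φ : H →ₗ[ℂ] (ℂ → ℂ)) (hΦ : Function.Injective Φ)
    (f : LinearMap.range Φ) :
    (imageCore Φ hΦ).toNormedAddCommGroup.toNorm.norm f =
      ‖(LinearEquiv.ofInjective Φ hΦ).symm f‖ := by
  rw [norm_eq_sqrt_re_inner (𝕜 := ℂ)]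
  rfl

variable [CompleteSpace H]

theorem imageCore_complete (Φ : H →ₗ[ℂ] (ℂ → ℂ)) (hΦ : Function.Injective Φ) :
    @CompleteSpace (LinearMap.range Φ)
      (imageCore Φ hΦ).toNormedAddCommGroup.toMetricSpace.toUniformSpace := by
  let _ : NormedAddCommGroup (LinearMap.range Φ) := (imageCore Φ hΦ).toNormedAddCommGroup
  let _ : InnerProductSpace ℂ (LinearMap.range Φ) :=
    InnerProductSpace.ofCore (imageCore Φ hΦ).toCore
  let e : LinearMap.range Φ ≃ₗᵢ[ℂ] H :=
    { (LinearEquiv.ofInjective Φ hΦ).symm with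
      norm_map' := fun f => (imageCore_norm Φ hΦ f).symm }
  exact e.toIsometryEquiv.completeSpace

/-- The image `{Φφ : φ ∈ H}` with the inner product `⟨Φη, Φφ⟩ := ⟨η, φ⟩`. -/
def imageSpace (Φ : H →ₗ[ℂ] (ℂ → ℂ)) (hΦ : Function.Injective Φ) : FunctionHilbertSpace where
  carrier := LinearMap.range Φ
  core := imageCore Φ hΦ
  complete := imageCore_complete Φ hΦ

/-- The map `φ ↦ Φφ` as a unitary map of `H` onto its image. -/
def imageUnitary (Φ : H →ₗ[ℂ] (ℂ → ℂ)) (hΦ : Function.Injective Φ) :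
    H ≃ₗᵢ[ℂ] (imageSpace Φ hΦ).Elem :=
  LinearIsometryEquiv.symm
    { toFun := fun f => (LinearEquiv.ofInjective Φ hΦ).symm f
      invFun := fun x => LinearEquiv.ofInjective Φ hΦ x
      map_add' := fun f g => (LinearEquiv.ofInjective Φ hΦ).symm.map_add f g
      map_smul' := fun c f => (LinearEquiv.ofInjective Φ hΦ).symm.map_smul c f
      left_inv := fun f => (LinearEquiv.ofInjective Φ hΦ).apply_symm_apply f
      right_inv := fun x => (LinearEquiv.ofInjective Φ hΦ).symm_apply_apply x
      norm_map' := fun f => (imageCore_norm Φ hΦ f).symm }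

theorem imageUnitary_fn (Φ : H →ₗ[ℂ] (ℂ → ℂ)) (hΦ : Function.Injective Φ) (φ : H) :
    (imageUnitary Φ hΦ φ).fn = Φ φ := rfl

/-- The unitary map `U` carries the operator `A` to the operator `S`: `S = U A U⁻¹`, including the
equality of the domains. -/
def Intertwines {K : Type*} [NormedAddCommGroup K] [InnerProductSpace ℂ K]
    (U : H ≃ₗᵢ[ℂ] K) (A : H →ₗ.[ℂ] H) (S : K →ₗ.[ℂ] K) : Prop :=
  ∀ x y : H, (x, y) ∈ A.graph ↔ (U x, U y) ∈ S.graph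

end Image

end DeBrangesModel

end

open DeBrangesModel

/-!
Let `A` be regular, closed and symmetric with deficiency indices `(1, 1)`, and write `N_z` for the
kernel of `A* - zI`, which is the orthogonal complement of the range of `A - z̄I`. Regularity makes
this range closed for every `z`.

**Extensions and their spectra.** Deficiency vectors of equal norm at `±i` give canonical
selfadjoint extensions by von Neumann's formula
(`IsClassS.isCanonicalExtension_sup_span`), and `A` is the intersection of two of them. Each
extension `B` exceeds the graph of `A` by one dimension, so that near an eigenvalue `x₀` the
regularity of `A` at `x₀` bounds `B - zI` below by `|z - x₀|`
(`IsClassS.exists_isBoundedBelowAt_near`). Hence the spectrum of `B` consists of isolated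
eigenvalues, and the resolvent has at most simple poles there. Weierstrass' theorem
(`exists_entire_simple_zeros`) supplies the function `h`.

**Deficiency vectors.** The operator `I + (z - w)(B - zI)⁻¹` maps `N_w` onto `N_z` for `w` and `z`
outside the spectrum of `B`, so `N_z` has dimension one there. The spaces `N_z` with nonreal `z`
span a dense subspace (`IsClassS.eq_zero_of_forall_inner_eq_zero`): on their common
orthogonal complement the resolvent of `B` at a real point is a symmetric operator without nonzero
real approximate eigenvalues, by regularity, and such an operator is zero
(`eq_zero_of_no_approximate_eigenvalue`).

**Involutions.** For `ψ` in `N_v` with real `v`, the inner products of the vectors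
`ψ(z) = ψ + (z - v)(B - zI)⁻¹ψ` have a symmetry that makes `ψ(z) ↦ ψ(z̄)` extend to an antilinear
isometry `J`. It leaves all canonical selfadjoint extensions invariant, because modulo `A` each of
them is a line, on which the boundary form vanishes, in a two-dimensional space spanned by
`J`-invariant vectors (`IsClassS.isCommutingInvolution`).

**The model.** The simple zeros of `h` cancel the poles of `ψ(z)`, which gives the entire function
`ξ`, and the residues of `ψ(z)` do not vanish, so that `ξ` has no zeros. The map `Φ` is injective
because the `ξ(z)` span a dense subspace. If `Φφ` vanishes at a nonreal `w`, then `φ = (A - wI) a`,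
and `(A - w̄I) a` has the same norm and is mapped to `(z - w̄)(z - w)⁻¹ (Φφ)(z)`; this is axiom
(A2), while (A3) expresses that `Φ` carries `J` to the conjugation `f ↦ f^#`. The same description
of the range of `A - iI` identifies the domain of multiplication by `z`
(`IsKernelFunction.mem_graph_iff`).
-/

namespace DeBrangesModel

open Filter Topology Complex

/-! ### Entire functions with prescribed simple zeros -/

/-- The Weierstrass elementary factor `(1 - w) exp (w + w² / 2 + ⋯ + wⁿ / n)`. The exponent is
written through the Taylor polynomial of `log (1 + ·)` at `-w`. -/
noncomputable def elementaryFactor (n : ℕ) (w : ℂ) : ℂ :=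
  (1 - w) * exp (-logTaylor (n + 1) (-w))

theorem differentiable_logTaylor (n : ℕ) : Differentiable ℂ (logTaylor n) := by
  cases n with
  | zero => rw [logTaylor_zero]; fun_prop
  | succ n => exact fun z => (hasDerivAt_logTaylor n z).differentiableAt

theorem differentiable_elementaryFactor (n : ℕ) : Differentiable ℂ (elementaryFactor n) := by
  have h := differentiable_logTaylor (n + 1)
  unfold elementaryFactor
  fun_prop

theorem elementaryFactor_eq_zero_iff {n : ℕ} {w : ℂ} : elementaryFactor n w = 0 ↔ w = 1 := by
  simp [elementaryFactor, sub_eq_zero, eq_comm (a := w)]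

theorem deriv_elementaryFactor_one (n : ℕ) : deriv (elementaryFactor n) 1 ≠ 0 := by
  have h := differentiable_logTaylor (n + 1)
  have h1 : HasDerivAt (fun w : ℂ => 1 - w) (-1) 1 := by
    simpa using (hasDerivAt_id (1 : ℂ)).const_sub 1
  have h2 : DifferentiableAt ℂ (fun w : ℂ => exp (-logTaylor (n + 1) (-w))) 1 := by fun_prop
  have h3 := (h1.mul h2.hasDerivAt).deriv
  have h4 : deriv (elementaryFactor n) 1 = -exp (-logTaylor (n + 1) (-1)) := by
    refine Eq.trans ?_ (h3.trans (by simp))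
    rfl
  rw [h4]
  exact neg_ne_zero.2 (exp_ne_zero _)

theorem elementaryFactor_conj (n : ℕ) (w : ℂ) :
    elementaryFactor n (conj w) = conj (elementaryFactor n w) := by
  simp [elementaryFactor, logTaylor, ← exp_conj]

/-- For `|w| ≤ 1 / 2` the elementary factor is the exponential of the remainder of the Taylor
expansion of `log (1 - w)`. -/
theorem norm_elementaryFactor_sub_one_le {n : ℕ} {w : ℂ} (hw : ‖w‖ ≤ 1 / 2) :
    ‖elementaryFactor n w - 1‖ ≤ 4 * (1 / 2) ^ (n + 1) := by
  have hw1 : ‖-w‖ < 1 := by rw [norm_neg]; linarith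
  have h1 : (1 : ℂ) - w ≠ 0 := by
    intro h
    rw [← sub_eq_zero.1 h] at hw
    norm_num at hw
  have hE : elementaryFactor n w = exp (log (1 + -w) - logTaylor (n + 1) (-w)) := by
    rw [sub_eq_add_neg, exp_add, ← sub_eq_add_neg, exp_log h1, elementaryFactor]
  have hp : ‖w‖ ^ (n + 1) ≤ (1 / 2) ^ (n + 1) := by gcongr
  have hp1 : ((1 : ℝ) / 2) ^ (n + 1) ≤ 1 / 2 := by
    rw [pow_succ]
    have := pow_le_one₀ (n := n) (by norm_num : (0 : ℝ) ≤ 1 / 2) (by norm_num)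
    linarith
  have hinv : (1 - ‖w‖)⁻¹ ≤ 2 := by
    rw [inv_le_comm₀ (by linarith) (by norm_num)]
    linarith
  have hu := norm_log_sub_logTaylor_le n hw1
  rw [norm_neg] at hu
  have hu2 : ‖w‖ ^ (n + 1) * (1 - ‖w‖)⁻¹ / (n + 1) ≤ (1 / 2) ^ (n + 1) * 2 := by
    refine (div_le_self (by have : 0 ≤ (1 - ‖w‖)⁻¹ := inv_nonneg.2 (by linarith)
                            positivity) (by linarith [n.cast_nonneg (α := ℝ)])).trans ?_
    exact mul_le_mul hp hinv (inv_nonneg.2 (by linarith)) (by positivity)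
  rw [hE]
  refine (norm_exp_sub_one_le (by linarith)).trans ?_
  linarith

/-- An infinite product of entire functions whose factors are close to `1`, with a summable bound
on each disc for all but finitely many factors, is entire. -/
theorem differentiable_tprod_one_add {ι : Type*} {f : ι → ℂ → ℂ} {u : ι → ℝ} (hu : Summable u)
    (hf : ∀ i, Differentiable ℂ (f i))
    (hb : ∀ R : ℝ, ∀ᶠ i in cofinite, ∀ z ∈ Metric.ball (0 : ℂ) R, ‖f i z‖ ≤ u i) :
    Differentiable ℂ fun z => ∏' i, (1 + f i z) := by
  intro z
  have h := hasProdLocallyUniformlyOn_iff_tendstoLocallyUniformlyOn.1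
    (hu.hasProdLocallyUniformlyOn_one_add (Metric.isOpen_ball (x := (0 : ℂ)) (ε := ‖z‖ + 1))
      (hb _) fun i => (hf i).continuous.continuousOn)
  refine (h.differentiableOn (Eventually.of_forall fun s => ?_) Metric.isOpen_ball).differentiableAt
    (Metric.isOpen_ball.mem_nhds (by simp))
  have : Differentiable ℂ fun z => ∏ i ∈ s, (1 + f i z) :=
    Differentiable.fun_finsetProd fun i _ => (hf i).const_add 1
  exact this.differentiableOn

theorem summable_norm_of_eventually_le {ι : Type*} {f : ι → ℂ → ℂ} {u : ι → ℝ} (hu : Summable u)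
    (hb : ∀ R : ℝ, ∀ᶠ i in cofinite, ∀ z ∈ Metric.ball (0 : ℂ) R, ‖f i z‖ ≤ u i) (z : ℂ) :
    Summable fun i => ‖f i z‖ := by
  refine hu.of_norm_bounded_eventually ?_
  filter_upwards [hb (‖z‖ + 1)] with i hi
  simpa using hi z (by simp)

/-- The Weierstrass product for a locally finite set of real points that does not contain `0`. The
degree of the elementary factor at `a` is the value at `a` of an injection of the set into `ℕ`, so
that a geometric series bounds the factors. -/
theorem exists_entire_simple_zeros_of_zero_notMem {S : Set ℂ} (hS : ∀ x, ∀ᶠ z in 𝓝[≠] x, z ∉ S)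
    (hreal : ∀ z ∈ S, conj z = z) (h0 : (0 : ℂ) ∉ S) :
    ∃ h : ℂ → ℂ, Differentiable ℂ h ∧ (∀ z, h (conj z) = conj (h z)) ∧
      (∀ z, h z = 0 ↔ z ∈ S) ∧ ∀ z, h z = 0 → deriv h z ≠ 0 := by
  classical
  have hcd : IsClosed S ∧ IsDiscrete S := by
    refine isClosed_and_discrete_iff.2 fun x => ?_
    rw [disjoint_principal_right]
    exact hS x
  have : DiscreteTopology S := hcd.2.to_subtype
  have : Countable S := TopologicalSpace.separableSpace_iff_countable.1 inferInstance
  obtain ⟨e, he⟩ := exists_injective_nat S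
  have hne : ∀ a : S, (a : ℂ) ≠ 0 := fun a ha => h0 (ha ▸ a.2)
  set f : S → ℂ → ℂ := fun a z => elementaryFactor (e a) (z / a) - 1 with hf_def
  set u : S → ℝ := fun a => 4 * (1 / 2) ^ (e a + 1) with hu_def
  have hu : Summable u :=
    (((summable_nat_add_iff 1).2 summable_geometric_two).comp_injective he).mul_left 4
  have hf : ∀ a, Differentiable ℂ (f a) := fun a =>
    ((differentiable_elementaryFactor (e a)).comp (differentiable_id.div_const _)).sub_const 1
  have hb : ∀ R : ℝ, ∀ᶠ a in cofinite, ∀ z ∈ Metric.ball (0 : ℂ) R, ‖f a z‖ ≤ u a := by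
    intro R
    have hfin : (Metric.closedBall (0 : ℂ) (2 * R) ∩ S).Finite :=
      ((isCompact_closedBall _ _).inter_right hcd.1).finite
        (hcd.2.mono Set.inter_subset_right)
    have hfin' : {a : S | ‖(a : ℂ)‖ ≤ 2 * R}.Finite := by
      refine Set.Finite.of_finite_image (f := Subtype.val) (hfin.subset ?_)
        Subtype.val_injective.injOn
      rintro _ ⟨a, ha, rfl⟩
      exact ⟨by simpa using ha, a.2⟩
    filter_upwards [hfin'.compl_mem_cofinite] with a ha z hz
    have ha' : 2 * R < ‖(a : ℂ)‖ := by simpa using ha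
    refine norm_elementaryFactor_sub_one_le ?_
    have hz' : ‖z‖ < R := by simpa using hz
    rw [norm_div, div_le_iff₀ (norm_pos_iff.2 (hne a))]
    linarith
  have hone : ∀ a z, 1 + f a z = elementaryFactor (e a) (z / a) := fun a z => by simp [hf_def]
  have hzero : ∀ a z, 1 + f a z = 0 ↔ z = a := fun a z => by
    rw [hone, elementaryFactor_eq_zero_iff, div_eq_one_iff_eq (hne a)]
  have hsum := summable_norm_of_eventually_le hu hb
  -- the product with one factor split off
  set g : S → ℂ → ℂ := fun a z => ∏' i, (1 + Function.update f a 0 i z) with hg_def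
  have hbg : ∀ a, ∀ R : ℝ, ∀ᶠ i in cofinite, ∀ z ∈ Metric.ball (0 : ℂ) R,
      ‖Function.update f a 0 i z‖ ≤ u i := by
    intro a R
    filter_upwards [hb R] with i hi z hz
    rcases eq_or_ne i a with rfl | hia
    · simp only [Function.update_self, Pi.zero_apply, norm_zero]
      exact (norm_nonneg _).trans (hi z hz)
    · simpa [hia] using hi z hz
  have hg : ∀ a, Differentiable ℂ (g a) := by
    intro a
    refine differentiable_tprod_one_add hu (fun i => ?_) (hbg a)
    rcases eq_or_ne i a with rfl | hia
    · simp only [Function.update_self]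
      exact differentiable_const 0
    · simpa [hia] using hf i
  have hsplit : ∀ a z, ∏' i, (1 + f i z) = (1 + f a z) * g a z := by
    intro a z
    have h1 : (fun i => 1 + Function.update f a 0 i z) =
        Function.update (fun i => 1 + f i z) a 1 := by
      funext i
      rcases eq_or_ne i a with rfl | hia <;> simp [*]
    have h2 := multipliable_one_add_of_summable (summable_norm_of_eventually_le hu (hbg a) z)
    rw [h1] at h2
    rw [Multipliable.tprod_eq_mul_tprod_ite' a h2]
    congr 1
    refine tprod_congr fun i => ?_
    rw [congrFun h1 i, Function.update_apply]
  have hiff : ∀ z, ∏' i, (1 + f i z) = 0 ↔ z ∈ S := by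
    intro z
    constructor
    · intro h
      by_contra hz
      refine tprod_one_add_ne_zero_of_summable (f := fun i => f i z) (fun a ha => ?_) (hsum z) h
      exact hz ((hzero a z).1 ha ▸ a.2)
    · intro hz
      rw [hsplit ⟨z, hz⟩ z, (hzero ⟨z, hz⟩ z).2 rfl, zero_mul]
  refine ⟨fun z => ∏' i, (1 + f i z), differentiable_tprod_one_add hu hf hb, fun z => ?_, hiff, ?_⟩
  · rw [(multipliable_one_add_of_summable (hsum z)).map_tprod (starRingEnd ℂ)
      continuous_conj]
    refine tprod_congr fun a => ?_
    rw [hone, hone, ← elementaryFactor_conj, map_div₀, hreal a a.2]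
  · intro z hz
    obtain ⟨a, rfl⟩ : ∃ a : S, (a : ℂ) = z := ⟨⟨z, (hiff z).1 hz⟩, rfl⟩
    have hga : g a a ≠ 0 := by
      refine tprod_one_add_ne_zero_of_summable (fun i hi => ?_)
        (summable_norm_of_eventually_le hu (hbg a) a)
      rcases eq_or_ne i a with rfl | hia
      · simp at hi
      · rw [Function.update_of_ne hia] at hi
        exact hia (Subtype.ext ((hzero i a).1 hi).symm)
    have hda : HasDerivAt (fun z => 1 + f a z)
        (deriv (elementaryFactor (e a)) 1 * (1 / a)) (a : ℂ) := by
      simp only [hone]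
      refine HasDerivAt.comp (h₂ := elementaryFactor (e a)) (h := fun z : ℂ => z / a) (a : ℂ) ?_
        ((hasDerivAt_id' (a : ℂ)).div_const (a : ℂ))
      rw [div_self (hne a)]
      exact (differentiable_elementaryFactor (e a) 1).hasDerivAt
    have hd := (hda.mul (hg a a).hasDerivAt).deriv
    have heq : (fun z => ∏' i, (1 + f i z)) = (fun z => 1 + f a z) * g a :=
      funext fun z => hsplit a z
    rw [heq, hd, (hzero a a).2 rfl, zero_mul, add_zero]
    exact mul_ne_zero (mul_ne_zero (deriv_elementaryFactor_one _) (one_div_ne_zero (hne a))) hga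

/-- **Weierstrass' theorem** for simple real zeros: a set of real points without accumulation
points is the zero set of a real entire function all of whose zeros are simple. -/
theorem exists_entire_simple_zeros {S : Set ℂ} (hS : ∀ x, ∀ᶠ z in 𝓝[≠] x, z ∉ S)
    (hreal : ∀ z ∈ S, conj z = z) {v : ℝ} (hv : (v : ℂ) ∉ S) :
    ∃ h : ℂ → ℂ, Differentiable ℂ h ∧ (∀ z, h (conj z) = conj (h z)) ∧
      (∀ z, h z = 0 ↔ z ∈ S) ∧ ∀ z, h z = 0 → deriv h z ≠ 0 := by
  have hS' : ∀ x, ∀ᶠ z in 𝓝[≠] x, z ∉ {z : ℂ | z + v ∈ S} := by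
    intro x
    have h2 : Tendsto (fun z : ℂ => z + v) (𝓝[≠] x) (𝓝[≠] (x + v)) :=
      ((continuous_add_const _).continuousWithinAt).tendsto_nhdsWithin
        fun z hz => by simpa using hz
    exact h2.eventually (hS (x + v))
  have hreal' : ∀ z ∈ {z : ℂ | z + v ∈ S}, conj z = z := by
    intro z hz
    have := hreal _ hz
    rw [map_add, conj_ofReal] at this
    exact add_right_cancel this
  obtain ⟨h, hd, hc, hz, hs⟩ :=
    exists_entire_simple_zeros_of_zero_notMem hS' hreal' (by simpa using hv)
  refine ⟨fun z => h (z - v), hd.comp (differentiable_id.sub_const _), fun z => ?_, fun z => ?_,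
    fun z h0 => ?_⟩
  · rw [← hc, map_sub, conj_ofReal]
  · simp [hz]
  · rw [deriv_comp_sub_const]
    exact hs _ h0

/-! ### Linear relations and their resolvents -/

section LinearRelations

variable {H : Type*} [NormedAddCommGroup H] [InnerProductSpace ℂ H]

theorem mem_relKer {T : Submodule ℂ (H × H)} {z : ℂ} {η : H} :
    η ∈ relKer T z ↔ (η, z • η) ∈ T := Iff.rfl

theorem mem_adjoint_iff_inner {T : Submodule ℂ (H × H)} {η ω : H} :
    (η, ω) ∈ T.adjoint ↔ ∀ a b, (a, b) ∈ T → inner ℂ b η = inner ℂ a ω := by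
  rw [Submodule.mem_adjoint_iff]
  exact forall₃_congr fun _ _ _ => sub_eq_zero

theorem isClosed_adjoint (T : Submodule ℂ (H × H)) : IsClosed (T.adjoint : Set (H × H)) := by
  have h : (T.adjoint : Set (H × H)) =
      ⋂ x ∈ T, {y : H × H | inner ℂ x.2 y.1 = inner ℂ x.1 y.2} := by
    ext ⟨η, ω⟩
    rw [SetLike.mem_coe, mem_adjoint_iff_inner]
    simp
  rw [h]
  exact isClosed_biInter fun x _ => isClosed_eq (by fun_prop) (by fun_prop)

/-- The range of `T - zI` for a linear relation `T`. -/
noncomputable def shiftRange (T : Submodule ℂ (H × H)) (z : ℂ) : Submodule ℂ H :=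
  T.map (LinearMap.snd ℂ H H - z • LinearMap.fst ℂ H H)

theorem mem_shiftRange {T : Submodule ℂ (H × H)} {z : ℂ} {u : H} :
    u ∈ shiftRange T z ↔ ∃ a b, (a, b) ∈ T ∧ b - z • a = u := by
  simp [shiftRange]

theorem mem_relKer_adjoint {T : Submodule ℂ (H × H)} {z : ℂ} {η : H} :
    η ∈ relKer T.adjoint z ↔ ∀ a b, (a, b) ∈ T → inner ℂ (b - conj z • a) η = 0 := by
  rw [mem_relKer, mem_adjoint_iff_inner]
  refine forall₃_congr fun a b _ => ?_
  rw [inner_sub_left, inner_smul_left, inner_smul_right, conj_conj, sub_eq_zero]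

theorem relKer_adjoint (T : Submodule ℂ (H × H)) (z : ℂ) :
    relKer T.adjoint z = (shiftRange T (conj z))ᗮ := by
  ext η
  rw [mem_relKer_adjoint, Submodule.mem_orthogonal]
  simp only [mem_shiftRange]
  exact ⟨fun h _ ⟨a, b, hab, hu⟩ => hu ▸ h a b hab, fun h a b hab => h _ ⟨a, b, hab, rfl⟩⟩

/-- The relation `T - zI` is bounded below by `d`. -/
def IsBoundedBelowAt (T : Submodule ℂ (H × H)) (z : ℂ) (d : ℝ) : Prop :=
  ∀ a b, (a, b) ∈ T → d * ‖a‖ ≤ ‖b - z • a‖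

theorem IsBoundedBelowAt.relKer_eq_bot {T : Submodule ℂ (H × H)} {z : ℂ} {d : ℝ}
    (h : IsBoundedBelowAt T z d) (hd : 0 < d) : relKer T z = ⊥ := by
  rw [Submodule.eq_bot_iff]
  intro η hη
  have := h η _ (mem_relKer.1 hη)
  rw [sub_self, norm_zero] at this
  exact norm_le_zero_iff.1 (nonpos_of_mul_nonpos_right this hd)

/-- The map `(a, b) ↦ b - z a` on a linear relation. -/
noncomputable def shiftMap (T : Submodule ℂ (H × H)) (z : ℂ) : T →L[ℂ] H :=
  (ContinuousLinearMap.snd ℂ H H - z • ContinuousLinearMap.fst ℂ H H).comp T.subtypeL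

theorem range_shiftMap (T : Submodule ℂ (H × H)) (z : ℂ) :
    Set.range (shiftMap T z) = shiftRange T z := by
  ext u
  rw [SetLike.mem_coe, mem_shiftRange]
  constructor
  · rintro ⟨x, rfl⟩
    exact ⟨x.1.1, x.1.2, x.2, rfl⟩
  · rintro ⟨a, b, hab, rfl⟩
    exact ⟨⟨(a, b), hab⟩, rfl⟩

theorem IsResolventAt.apply {T : Submodule ℂ (H × H)} {z : ℂ} {R : H →L[ℂ] H}
    (hR : IsResolventAt T z R) {η ω : H} (h : (η, ω) ∈ T) : R (ω - z • η) = η :=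
  (hR _ _).1 (by rwa [sub_add_cancel])

theorem IsResolventAt.mem {T : Submodule ℂ (H × H)} {z : ℂ} {R : H →L[ℂ] H}
    (hR : IsResolventAt T z R) (u : H) : (R u, u + z • R u) ∈ T :=
  (hR _ _).2 rfl

theorem IsResolventAt.eq {T : Submodule ℂ (H × H)} {z : ℂ} {R R' : H →L[ℂ] H}
    (hR : IsResolventAt T z R) (hR' : IsResolventAt T z R') : R = R' := by
  ext u
  exact ((hR' u _).1 (hR.mem u)).symm

theorem isResolventAt_relResolvent {T : Submodule ℂ (H × H)} {z : ℂ} (hz : z ∉ relSpectrum T) :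
    IsResolventAt T z (relResolvent T z) := by
  have h : ∃ R : H →L[ℂ] H, IsResolventAt T z R := not_not.1 hz
  rw [relResolvent, dif_pos h]
  exact h.choose_spec

theorem IsResolventAt.notMem_relSpectrum {T : Submodule ℂ (H × H)} {z : ℂ} {R : H →L[ℂ] H}
    (hR : IsResolventAt T z R) : z ∉ relSpectrum T := not_not.2 ⟨R, hR⟩

theorem IsResolventAt.relResolvent_eq {T : Submodule ℂ (H × H)} {z : ℂ} {R : H →L[ℂ] H}
    (hR : IsResolventAt T z R) : relResolvent T z = R :=
  (isResolventAt_relResolvent hR.notMem_relSpectrum).eq hR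

theorem IsResolventAt.norm_le {T : Submodule ℂ (H × H)} {z : ℂ} {R : H →L[ℂ] H} {d : ℝ}
    (hR : IsResolventAt T z R) (hd : 0 < d) (h : IsBoundedBelowAt T z d) : ‖R‖ ≤ d⁻¹ := by
  refine R.opNorm_le_bound (inv_nonneg.2 hd.le) fun u => ?_
  have := h _ _ (hR.mem u)
  rw [add_sub_cancel_right] at this
  rwa [inv_mul_eq_div, le_div_iff₀' hd]

/-- The first resolvent identity. -/
theorem IsResolventAt.sub_eq {T : Submodule ℂ (H × H)} {z w : ℂ} {R S : H →L[ℂ] H}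
    (hR : IsResolventAt T z R) (hS : IsResolventAt T w S) (u : H) :
    R u - S u = (z - w) • R (S u) := by
  have h := hR.apply (hS.mem u)
  have h2 : u + w • S u - z • S u = u - (z - w) • S u := by module
  rw [h2, map_sub, map_smul] at h
  exact sub_eq_iff_eq_add.2 (sub_eq_iff_eq_add'.1 h)

/-- The resolvent at points near `w` is obtained from the resolvent at `w` by a Neumann series. -/
theorem IsResolventAt.perturb {T : Submodule ℂ (H × H)} {z w : ℂ} {R : H →L[ℂ] H}
    (hR : IsResolventAt T w R) (hu : IsUnit (1 - (z - w) • R)) :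
    IsResolventAt T z (Ring.inverse (1 - (z - w) • R) * R) := by
  intro u η
  have h1 : u + z • η = (u + (z - w) • η) + w • η := by module
  rw [h1, hR, map_add, map_smul]
  have h2 : R u + (z - w) • R η = η ↔ (1 - (z - w) • R) η = R u := by
    change _ ↔ η - (z - w) • R η = R u
    rw [sub_eq_iff_eq_add]
    exact eq_comm
  rw [h2, mul_apply_eq_comp]
  constructor
  · intro h
    rw [← h, ← mul_apply_eq_comp, Ring.inverse_mul_cancel _ hu]
    rfl
  · intro h
    rw [← h, ← mul_apply_eq_comp, Ring.mul_inverse_cancel _ hu]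
    rfl

/-- A symmetric relation is bounded below by `|Im z|` at `z`. -/
theorem isBoundedBelowAt_im {B : Submodule ℂ (H × H)} (hB : B ≤ B.adjoint) (z : ℂ) :
    IsBoundedBelowAt B z |z.im| := by
  intro a b hab
  have hs : inner ℂ b a = inner ℂ a b := mem_adjoint_iff_inner.1 (hB hab) a b hab
  have him : (inner ℂ a b : ℂ).im = 0 := by
    rw [← inner_conj_symm] at hs
    exact conj_eq_iff_im.1 hs
  have h1 : (inner ℂ a (b - z • a) : ℂ).im = -z.im * ‖a‖ ^ 2 := by
    rw [inner_sub_right, inner_smul_right, inner_self_eq_norm_sq_to_K, sub_im, him]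
    simp [← ofReal_pow]
  have h2 : |z.im| * ‖a‖ ^ 2 ≤ ‖a‖ * ‖b - z • a‖ := by
    calc |z.im| * ‖a‖ ^ 2 = |(inner ℂ a (b - z • a) : ℂ).im| := by
          rw [h1, abs_mul, abs_neg, abs_of_nonneg (sq_nonneg ‖a‖)]
      _ ≤ ‖(inner ℂ a (b - z • a) : ℂ)‖ := abs_im_le_norm _
      _ ≤ _ := norm_inner_le_norm _ _
  rcases (norm_nonneg a).eq_or_lt with h0 | h0
  · rw [← h0, mul_zero]
    positivity
  · refine le_of_mul_le_mul_left ?_ h0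
    linarith [h2, sq ‖a‖, mul_left_comm ‖a‖ |z.im| ‖a‖, congrArg (|z.im| * ·) (sq ‖a‖)]

variable [CompleteSpace H]

theorem eventually_isUnit_one_sub_smul (w : ℂ) (R : H →L[ℂ] H) :
    ∀ᶠ z in 𝓝 w, IsUnit (1 - (z - w) • R) := by
  have hc : ContinuousAt (fun z : ℂ => 1 - (z - w) • R) w := by fun_prop
  refine hc.eventually (Units.isOpen.mem_nhds ?_)
  simp [isUnit_one]

theorem isOpen_compl_relSpectrum (T : Submodule ℂ (H × H)) : IsOpen (relSpectrum T)ᶜ := by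
  refine isOpen_iff_mem_nhds.2 fun w hw => ?_
  filter_upwards [eventually_isUnit_one_sub_smul w (relResolvent T w)] with z hz
  exact ((isResolventAt_relResolvent hw).perturb hz).notMem_relSpectrum

theorem differentiableAt_relResolvent {T : Submodule ℂ (H × H)} {w : ℂ}
    (hw : w ∉ relSpectrum T) : DifferentiableAt ℂ (relResolvent T) w := by
  have hR := isResolventAt_relResolvent hw
  have h1 : relResolvent T =ᶠ[𝓝 w]
      fun z => Ring.inverse (1 - (z - w) • relResolvent T w) * relResolvent T w := by
    filter_upwards [eventually_isUnit_one_sub_smul w (relResolvent T w)] with z hz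
    exact (hR.perturb hz).relResolvent_eq
  refine DifferentiableAt.congr_of_eventuallyEq ?_ h1
  have h2 : DifferentiableAt ℂ (Ring.inverse : (H →L[ℂ] H) → (H →L[ℂ] H))
      (1 - (w - w) • relResolvent T w) :=
    differentiableAt_inverse (by simp [isUnit_one])
  have h3 : DifferentiableAt ℂ (fun z : ℂ => 1 - (z - w) • relResolvent T w) w := by fun_prop
  exact (h2.comp (f := fun z : ℂ => 1 - (z - w) • relResolvent T w) w h3).mul_const _

theorem IsBoundedBelowAt.isClosed_shiftRange {T : Submodule ℂ (H × H)} {z : ℂ} {d : ℝ}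
    (h : IsBoundedBelowAt T z d) (hd : 0 < d) (hT : IsClosed (T : Set (H × H))) :
    IsClosed (shiftRange T z : Set H) := by
  have : CompleteSpace T := hT.completeSpace_coe
  rw [← range_shiftMap]
  have hK : (0 : ℝ) ≤ 1 + (1 + ‖z‖) / d := by positivity
  refine (AddMonoidHomClass.antilipschitz_of_bound (shiftMap T z)
    (K := ⟨1 + (1 + ‖z‖) / d, hK⟩) fun x => ?_).isClosed_range (shiftMap T z).uniformContinuous
  obtain ⟨⟨a, b⟩, hx⟩ := x
  have h1 : ‖a‖ ≤ ‖b - z • a‖ / d := by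
    rw [le_div_iff₀' hd]
    exact h a b hx
  have h2 : ‖b‖ ≤ ‖b - z • a‖ + ‖z‖ * ‖a‖ := by
    rw [← norm_smul]
    simpa using norm_add_le (b - z • a) (z • a)
  change max ‖a‖ ‖b‖ ≤ (1 + (1 + ‖z‖) / d) * ‖b - z • a‖
  have h3 : ‖z‖ * ‖a‖ ≤ ‖z‖ * (‖b - z • a‖ / d) := by gcongr
  have h4 : (1 + (1 + ‖z‖) / d) * ‖b - z • a‖ =
      ‖b - z • a‖ + ‖b - z • a‖ / d + ‖z‖ * (‖b - z • a‖ / d) := by ring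
  rw [h4]
  have h5 : 0 ≤ ‖z‖ * (‖b - z • a‖ / d) := by positivity
  have h6 : 0 ≤ ‖b - z • a‖ / d := by positivity
  exact max_le (by linarith [norm_nonneg (b - z • a)]) (by linarith)

/-- For a selfadjoint relation `B`, the point `z` belongs to the resolvent set as soon as `B - zI`
and `B - z̄I` are injective and `B - zI` has closed range. -/
theorem exists_isResolventAt {B : Submodule ℂ (H × H)} (hB : B.adjoint = B) {z : ℂ}
    (hcl : IsClosed (shiftRange B z : Set H)) (hker : relKer B z = ⊥)
    (hker' : relKer B (conj z) = ⊥) : ∃ R : H →L[ℂ] H, IsResolventAt B z R := by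
  have hBc : IsClosed (B : Set (H × H)) := hB ▸ isClosed_adjoint B
  have : CompleteSpace B := hBc.completeSpace_coe
  have htop : shiftRange B z = ⊤ := by
    have h1 := relKer_adjoint B (conj z)
    rw [hB, hker', conj_conj] at h1
    have : CompleteSpace (shiftRange B z) := hcl.completeSpace_coe
    exact Submodule.orthogonal_eq_bot_iff.1 h1.symm
  have hinj : (shiftMap B z : B →ₗ[ℂ] H).ker = ⊥ := by
    rw [Submodule.eq_bot_iff]
    rintro ⟨⟨a, b⟩, hab⟩ hx
    have hx' : b - z • a = 0 := hx
    have hb : b = z • a := sub_eq_zero.1 hx'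
    subst hb
    have ha : a ∈ relKer B z := hab
    rw [hker, Submodule.mem_bot] at ha
    subst ha
    exact Subtype.ext (by simp)
  have hsurj : (shiftMap B z : B →ₗ[ℂ] H).range = ⊤ := by
    rw [← SetLike.coe_set_eq, LinearMap.coe_range]
    exact (range_shiftMap B z).trans (by rw [htop])
  let e := ContinuousLinearEquiv.ofBijective (shiftMap B z) hinj hsurj
  refine ⟨((ContinuousLinearMap.fst ℂ H H).comp B.subtypeL).comp e.symm.toContinuousLinearMap,
    fun u η => ?_⟩
  constructor
  · intro h
    have h1 : e ⟨_, h⟩ = u := by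
      change u + z • η - z • η = u
      abel
    change (e.symm u).1.1 = η
    rw [← h1, e.symm_apply_apply]
  · intro h
    have h1 : (e.symm u).1.2 - z • (e.symm u).1.1 = u := e.apply_symm_apply u
    have h2 : (e.symm u).1.1 = η := h
    rw [h2, sub_eq_iff_eq_add] at h1
    have h3 : (e.symm u).1 = (η, u + z • η) := Prod.ext h2 h1
    rw [← h3]
    exact (e.symm u).2

theorem exists_isResolventAt_of_isBoundedBelowAt {B : Submodule ℂ (H × H)} (hB : B.adjoint = B)
    {z : ℂ} {d d' : ℝ} (hd : 0 < d) (h : IsBoundedBelowAt B z d) (hd' : 0 < d')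
    (h' : IsBoundedBelowAt B (conj z) d') : ∃ R : H →L[ℂ] H, IsResolventAt B z R :=
  exists_isResolventAt hB (h.isClosed_shiftRange hd (hB ▸ isClosed_adjoint B))
    (h.relKer_eq_bot hd) (h'.relKer_eq_bot hd')

/-- The spectrum of a selfadjoint relation is real. -/
theorem notMem_relSpectrum_of_im_ne_zero {B : Submodule ℂ (H × H)} (hB : B.adjoint = B) {z : ℂ}
    (hz : z.im ≠ 0) : z ∉ relSpectrum B := by
  obtain ⟨R, hR⟩ := exists_isResolventAt_of_isBoundedBelowAt hB (abs_pos.2 hz)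
    (isBoundedBelowAt_im hB.ge z) (d' := |(conj z).im|) (by simpa using hz)
    (isBoundedBelowAt_im hB.ge _)
  exact hR.notMem_relSpectrum

theorem conj_eq_of_mem_relSpectrum {B : Submodule ℂ (H × H)} (hB : B.adjoint = B) {z : ℂ}
    (hz : z ∈ relSpectrum B) : conj z = z := by
  by_contra h
  exact notMem_relSpectrum_of_im_ne_zero hB (fun h0 => h (conj_eq_iff_im.2 h0)) hz

theorem conj_notMem_relSpectrum {B : Submodule ℂ (H × H)} (hB : B.adjoint = B) {z : ℂ}
    (hz : z ∉ relSpectrum B) : conj z ∉ relSpectrum B := by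
  intro h
  have := conj_eq_of_mem_relSpectrum hB h
  rw [conj_conj] at this
  exact hz (this ▸ h)

/-- The adjoint of the resolvent of a selfadjoint relation at `z` is its resolvent at `z̄`. -/
theorem inner_relResolvent_left {B : Submodule ℂ (H × H)} (hB : B.adjoint = B) {z : ℂ}
    (hz : z ∉ relSpectrum B) (x y : H) :
    inner ℂ (relResolvent B z x) y = inner ℂ x (relResolvent B (conj z) y) := by
  have h1 := (isResolventAt_relResolvent hz).mem x
  have h2 := (isResolventAt_relResolvent (conj_notMem_relSpectrum hB hz)).mem y
  have h3 := mem_adjoint_iff_inner.1 (hB.ge h2) _ _ h1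
  rw [inner_add_left, inner_add_right, inner_smul_left, inner_smul_right] at h3
  exact (add_right_cancel h3).symm

end LinearRelations

/-! ### Canonical selfadjoint extensions -/

section Extensions

variable {H : Type*} [NormedAddCommGroup H] [InnerProductSpace ℂ H]

theorem mem_sup_span_singleton {G : Submodule ℂ (H × H)} {p x : H × H} :
    x ∈ G ⊔ Submodule.span ℂ {p} ↔ ∃ c : ℂ, x - c • p ∈ G := by
  rw [Submodule.mem_sup]
  constructor
  · rintro ⟨g, hg, y, hy, rfl⟩
    obtain ⟨c, rfl⟩ := Submodule.mem_span_singleton.1 hy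
    exact ⟨c, by rwa [add_sub_cancel_right]⟩
  · rintro ⟨c, hc⟩
    exact ⟨_, hc, c • p, Submodule.smul_mem _ _ (Submodule.mem_span_singleton_self p),
      sub_add_cancel _ _⟩

theorem mem_adjoint_symm {T : Submodule ℂ (H × H)} {η ω a b : H} (h : (η, ω) ∈ T.adjoint)
    (hab : (a, b) ∈ T) : inner ℂ ω a = inner ℂ η b := by
  rw [← inner_conj_symm, ← inner_conj_symm η, mem_adjoint_iff_inner.1 h a b hab]

/-- Adding to a symmetric relation `G` an element of `G*` with vanishing boundary form gives a
symmetric relation. -/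
theorem sup_span_singleton_le_adjoint {G : Submodule ℂ (H × H)} (hG : G ≤ G.adjoint) {p q : H}
    (hp : (p, q) ∈ G.adjoint) (hpq : inner ℂ q p = inner ℂ p q) :
    G ⊔ Submodule.span ℂ {(p, q)} ≤ (G ⊔ Submodule.span ℂ {(p, q)}).adjoint := by
  rintro ⟨η, ω⟩ hx
  rw [mem_adjoint_iff_inner]
  intro a b hab
  obtain ⟨c, hc⟩ := mem_sup_span_singleton.1 hx
  obtain ⟨c', hc'⟩ := mem_sup_span_singleton.1 hab
  set g := η - c • p with hg
  set k := ω - c • q with hk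
  set g' := a - c' • p with hg'
  set k' := b - c' • q with hk'
  change (g, k) ∈ G at hc
  change (g', k') ∈ G at hc'
  have e1 : η = g + c • p := by rw [hg, sub_add_cancel]
  have e2 : ω = k + c • q := by rw [hk, sub_add_cancel]
  have e3 : a = g' + c' • p := by rw [hg', sub_add_cancel]
  have e4 : b = k' + c' • q := by rw [hk', sub_add_cancel]
  have h1 := mem_adjoint_iff_inner.1 (hG hc) _ _ hc'
  have h2 := mem_adjoint_iff_inner.1 hp _ _ hc'
  have h3 := mem_adjoint_symm hp hc
  rw [e1, e2, e3, e4]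
  simp only [inner_add_left, inner_add_right, inner_smul_left, inner_smul_right, h1, h2, h3, hpq]

/-- A symmetric relation `B` is selfadjoint if the ranges of `B ∓ iI` are the whole space. -/
theorem adjoint_eq_of_shiftRange_eq_top {B : Submodule ℂ (H × H)} (hB : B ≤ B.adjoint)
    (h1 : shiftRange B I = ⊤) (h2 : shiftRange B (-I) = ⊤) : B.adjoint = B := by
  refine le_antisymm ?_ hB
  rintro ⟨η, ω⟩ hx
  obtain ⟨a, b, hab, hu⟩ := mem_shiftRange.1 (h1 ▸ Submodule.mem_top : ω - I • η ∈ shiftRange B I)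
  have h3 : (η - a, ω - b) ∈ B.adjoint := sub_mem hx (hB hab)
  have h4 : ω - b = I • (η - a) := by
    rw [smul_sub, sub_eq_sub_iff_sub_eq_sub, ← hu]
  rw [h4, ← mem_relKer, relKer_adjoint, conj_I, h2, Submodule.top_orthogonal_eq_bot,
    Submodule.mem_bot] at h3
  rw [h3, smul_zero, sub_eq_zero] at h4
  rwa [h4, sub_eq_zero.1 h3]

variable {A : H →ₗ.[ℂ] H}

theorem IsClassS.graph_le_adjoint (hA : IsClassS A) : A.graph ≤ A.graph.adjoint := by
  rintro ⟨η, ω⟩ hx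
  rw [mem_adjoint_iff_inner]
  intro a b hab
  obtain ⟨x, rfl, rfl⟩ := A.mem_graph_iff.1 hx
  obtain ⟨y, rfl, rfl⟩ := A.mem_graph_iff.1 hab
  exact hA.symmetric y x

theorem IsClassS.exists_isBoundedBelowAt (hA : IsClassS A) (z : ℂ) :
    ∃ d, 0 < d ∧ IsBoundedBelowAt A.graph z d := by
  obtain ⟨d, hd, h⟩ := hA.regular z
  refine ⟨d, hd, fun a b hab => ?_⟩
  obtain ⟨x, rfl, rfl⟩ := A.mem_graph_iff.1 hab
  exact h x

theorem IsClassS.relKer_graph (hA : IsClassS A) (z : ℂ) : relKer A.graph z = ⊥ := by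
  obtain ⟨d, hd, h⟩ := hA.exists_isBoundedBelowAt z
  exact h.relKer_eq_bot hd

theorem IsCanonicalExtension.le_adjoint {B : Submodule ℂ (H × H)} (hB : IsCanonicalExtension A B) :
    B ≤ A.graph.adjoint := by
  rintro ⟨η, ω⟩ hx
  rw [mem_adjoint_iff_inner]
  exact fun a b hab => mem_adjoint_iff_inner.1 (hB.2.ge hx) a b (hB.1 hab)

theorem shiftRange_mono {T T' : Submodule ℂ (H × H)} (h : T ≤ T') (z : ℂ) :
    shiftRange T z ≤ shiftRange T' z := Submodule.map_mono h

theorem add_mem_adjoint_of_mem_relKer {e₁ e₂ : H} (h₁ : e₁ ∈ relKer A.graph.adjoint I)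
    (h₂ : e₂ ∈ relKer A.graph.adjoint (-I)) :
    (e₁ + e₂, I • e₁ - I • e₂) ∈ A.graph.adjoint := by
  have h := add_mem (mem_relKer.1 h₁) (mem_relKer.1 h₂)
  rwa [Prod.mk_add_mk, neg_smul, ← sub_eq_add_neg] at h

theorem IsClassS.exists_deficiency_vectors (hA : IsClassS A) :
    ∃ e₁ ∈ relKer A.graph.adjoint I, ∃ e₂ ∈ relKer A.graph.adjoint (-I),
      e₁ ≠ 0 ∧ ‖e₁‖ = ‖e₂‖ := by
  obtain ⟨⟨x, hx⟩, hx0, -⟩ := finrank_eq_one_iff'.1 hA.deficiency_upper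
  obtain ⟨⟨y, hy⟩, hy0, -⟩ := finrank_eq_one_iff'.1 hA.deficiency_lower
  have hx' : x ≠ 0 := fun h => hx0 (Subtype.ext h)
  have hy' : y ≠ 0 := fun h => hy0 (Subtype.ext h)
  refine ⟨(‖y‖ : ℂ) • x, Submodule.smul_mem _ _ hx, (‖x‖ : ℂ) • y, Submodule.smul_mem _ _ hy,
    smul_ne_zero (by simpa using hy') hx', ?_⟩
  simp [norm_smul, mul_comm]

variable [CompleteSpace H]

theorem IsClassS.isClosed_shiftRange (hA : IsClassS A) (z : ℂ) :
    IsClosed (shiftRange A.graph z : Set H) := by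
  obtain ⟨d, hd, h⟩ := hA.exists_isBoundedBelowAt z
  exact h.isClosed_shiftRange hd hA.closed

theorem IsClassS.shiftRange_eq (hA : IsClassS A) (z : ℂ) :
    shiftRange A.graph z = (relKer A.graph.adjoint (conj z))ᗮ := by
  have : CompleteSpace (shiftRange A.graph z) := (hA.isClosed_shiftRange z).completeSpace_coe
  rw [relKer_adjoint, conj_conj, Submodule.orthogonal_orthogonal]

theorem IsClassS.mem_shiftRange_of_inner_eq_zero (hA : IsClassS A) {z : ℂ}
    (hfr : Module.finrank ℂ (relKer A.graph.adjoint (conj z)) = 1) {e u : H}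
    (he : e ∈ relKer A.graph.adjoint (conj z)) (he0 : e ≠ 0) (h : inner ℂ e u = 0) :
    u ∈ shiftRange A.graph z := by
  rw [hA.shiftRange_eq, Submodule.mem_orthogonal]
  intro η hη
  obtain ⟨c, hc⟩ := (finrank_eq_one_iff_of_nonzero' (⟨e, he⟩ : relKer A.graph.adjoint (conj z))
    (by simpa using he0)).1 hfr ⟨η, hη⟩
  have hc' : c • e = η := congrArg Subtype.val hc
  rw [← hc', inner_smul_left, h, mul_zero]

/-- The whole space is spanned by the range of `A - zI` and a nonzero vector of the deficiency
space at `z̄`. -/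
theorem IsClassS.exists_sub_smul_mem_shiftRange (hA : IsClassS A) {z : ℂ}
    (hfr : Module.finrank ℂ (relKer A.graph.adjoint (conj z)) = 1) {e : H}
    (he : e ∈ relKer A.graph.adjoint (conj z)) (he0 : e ≠ 0) (u : H) :
    ∃ c : ℂ, u - c • e ∈ shiftRange A.graph z := by
  refine ⟨inner ℂ e u / inner ℂ e e, hA.mem_shiftRange_of_inner_eq_zero hfr he he0 ?_⟩
  rw [inner_sub_right, inner_smul_right, div_mul_cancel₀ _ (inner_self_ne_zero.2 he0), sub_self]

/-- A relation that contains the graph of `A` and whose shift at `z` hits a multiple of a deficiency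
vector at `z̄` has full range at `z`. -/
theorem IsClassS.shiftRange_eq_top (hA : IsClassS A) {B : Submodule ℂ (H × H)}
    (hAB : A.graph ≤ B) {z : ℂ}
    (hfr : Module.finrank ℂ (relKer A.graph.adjoint (conj z)) = 1) {e : H}
    (he : e ∈ relKer A.graph.adjoint (conj z)) (he0 : e ≠ 0) {s : ℂ} (hs : s ≠ 0)
    (hse : s • e ∈ shiftRange B z) : shiftRange B z = ⊤ := by
  rw [Submodule.eq_top_iff']
  intro u
  obtain ⟨c, hc⟩ := hA.exists_sub_smul_mem_shiftRange hfr he he0 u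
  have h1 : u = (u - c • e) + (c / s) • s • e := by
    rw [smul_smul, div_mul_cancel₀ _ hs, sub_add_cancel]
  rw [h1]
  exact add_mem (shiftRange_mono hAB z hc) (Submodule.smul_mem _ _ hse)

/-- Von Neumann's description of selfadjoint extensions: deficiency vectors `e₁`, `e₂` at `i` and
`-i` of equal norm give the extension of `A` spanned by its graph and `(e₁ + e₂, i e₁ - i e₂)`. -/
theorem IsClassS.isCanonicalExtension_sup_span (hA : IsClassS A) {e₁ e₂ : H}
    (h₁ : e₁ ∈ relKer A.graph.adjoint I) (h₂ : e₂ ∈ relKer A.graph.adjoint (-I))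
    (h₀ : e₁ ≠ 0) (hn : ‖e₁‖ = ‖e₂‖) :
    IsCanonicalExtension A
      (A.graph ⊔ Submodule.span ℂ {(e₁ + e₂, I • e₁ - I • e₂)}) := by
  have h₀' : e₂ ≠ 0 := norm_pos_iff.1 (hn ▸ norm_pos_iff.2 h₀)
  refine ⟨le_sup_left, ?_⟩
  have hp : (e₁ + e₂, I • e₁ - I • e₂) ∈ A.graph ⊔ Submodule.span ℂ {(e₁ + e₂, I • e₁ - I • e₂)} :=
    (le_sup_right : Submodule.span ℂ _ ≤ _) (Submodule.mem_span_singleton_self _)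
  refine adjoint_eq_of_shiftRange_eq_top (sup_span_singleton_le_adjoint hA.graph_le_adjoint
    (add_mem_adjoint_of_mem_relKer h₁ h₂) ?_) ?_ ?_
  · simp only [inner_add_left, inner_add_right, inner_sub_left, inner_sub_right, inner_smul_left,
      inner_smul_right, inner_self_eq_norm_sq_to_K, hn, conj_I]
    ring
  · refine hA.shiftRange_eq_top le_sup_left (by rw [conj_I]; exact hA.deficiency_lower)
      (by rwa [conj_I]) h₀' (s := -2 * I) (by simp) (mem_shiftRange.2 ⟨_, _, hp, ?_⟩)
    module
  · refine hA.shiftRange_eq_top le_sup_left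
      (by rw [map_neg, conj_I, neg_neg]; exact hA.deficiency_upper)
      (by rwa [map_neg, conj_I, neg_neg]) h₀ (s := 2 * I) (by simp)
      (mem_shiftRange.2 ⟨_, _, hp, ?_⟩)
    module

/-- The operator `A` is the intersection of two of its canonical selfadjoint extensions. -/
theorem IsClassS.exists_extensions_inf_le (hA : IsClassS A) :
    ∃ B B', IsCanonicalExtension A B ∧ IsCanonicalExtension A B' ∧ B ⊓ B' ≤ A.graph := by
  obtain ⟨e₁, h₁, e₂, h₂, h₀, hn⟩ := hA.exists_deficiency_vectors
  have h₂' : -e₂ ∈ relKer A.graph.adjoint (-I) := neg_mem h₂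
  have h₀' : e₂ ≠ 0 := norm_pos_iff.1 (hn ▸ norm_pos_iff.2 h₀)
  refine ⟨_, _, hA.isCanonicalExtension_sup_span h₁ h₂ h₀ hn,
    hA.isCanonicalExtension_sup_span h₁ h₂' h₀ (by rwa [norm_neg]), ?_⟩
  rintro x ⟨hx, hx'⟩
  obtain ⟨c, hc⟩ := mem_sup_span_singleton.1 hx
  obtain ⟨c', hc'⟩ := mem_sup_span_singleton.1 hx'
  have hd := sub_mem hc' hc
  -- The difference is `(α e₁ + β e₂, i α e₁ - i β e₂)` with `α = c - c'` and `β = c + c'`. Its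
  -- shifts at `-i` and `i` are `2iα e₁` and `-2iβ e₂`, and they lie in the ranges of `A + iI` and
  -- `A - iI`, which are orthogonal to `e₁` and `e₂`.
  have key : ∀ {α β : ℂ}, (α • e₁ + β • e₂, I • α • e₁ - I • β • e₂) ∈ A.graph → α = 0 ∧ β = 0 := by
    intro α β h
    have k1 := mem_relKer_adjoint.1 h₁ _ _ h
    have k2 := mem_relKer_adjoint.1 h₂ _ _ h
    have m1 : I • α • e₁ - I • β • e₂ - conj I • (α • e₁ + β • e₂) = (2 * I * α) • e₁ := by
      rw [conj_I]; module
    have m2 : I • α • e₁ - I • β • e₂ - conj (-I) • (α • e₁ + β • e₂) = (-2 * I * β) • e₂ := by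
      rw [map_neg, conj_I, neg_neg]; module
    rw [m1, inner_smul_left] at k1
    rw [m2, inner_smul_left] at k2
    constructor
    · simpa [h₀] using k1
    · simpa [h₀'] using k2
  have hd' : ((c - c') • e₁ + (c + c') • e₂, I • (c - c') • e₁ - I • (c + c') • e₂) ∈ A.graph := by
    convert hd using 1
    refine Prod.ext ?_ ?_
    · change (c - c') • e₁ + (c + c') • e₂ =
        (x.1 - c' • (e₁ + -e₂)) - (x.1 - c • (e₁ + e₂))
      module
    · change I • (c - c') • e₁ - I • (c + c') • e₂ =
        (x.2 - c' • (I • e₁ - I • -e₂)) - (x.2 - c • (I • e₁ - I • e₂))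
      module
  obtain ⟨k1, k2⟩ := key hd'
  have hc0 : c = 0 := by linear_combination (k1 + k2) / 2
  rwa [hc0, zero_smul, sub_zero] at hc

/-! ### The spectrum of a canonical selfadjoint extension -/

/-- A canonical selfadjoint extension is spanned by the graph of `A` and one further element. -/
theorem IsClassS.exists_generator (hA : IsClassS A) {B : Submodule ℂ (H × H)}
    (hB : IsCanonicalExtension A B) : ∃ p ∈ B, ∀ x ∈ B, ∃ c : ℂ, x - c • p ∈ A.graph := by
  obtain ⟨⟨e, he⟩, he0, -⟩ := finrank_eq_one_iff'.1 hA.deficiency_lower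
  have he0' : e ≠ 0 := fun h => he0 (Subtype.ext h)
  have hI : I ∉ relSpectrum B := notMem_relSpectrum_of_im_ne_zero hB.2 (by simp)
  have hR := isResolventAt_relResolvent hI
  refine ⟨_, hR.mem e, ?_⟩
  rintro ⟨η, ω⟩ hx
  obtain ⟨c, hc⟩ := hA.exists_sub_smul_mem_shiftRange (z := I)
    (by rw [conj_I]; exact hA.deficiency_lower) (by rwa [conj_I]) he0' (ω - I • η)
  obtain ⟨a, b, hab, hu⟩ := mem_shiftRange.1 hc
  refine ⟨c, ?_⟩
  have h1 := hR.apply hx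
  have h2 := hR.apply (hB.1 hab)
  rw [hu, map_sub, map_smul, h1] at h2
  have h3 : (η, ω) - c • (relResolvent B I e, e + I • relResolvent B I e) = (a, b) := by
    refine Prod.ext h2 ?_
    change ω - c • (e + I • relResolvent B I e) = b
    rw [sub_eq_iff_eq_add.1 hu, ← h2]
    module
  rwa [h3]

/-- An eigenvector of `B`, together with the graph of `A`, spans `B`. -/
theorem IsClassS.exists_sub_smul_eigenvector_mem (hA : IsClassS A) {B : Submodule ℂ (H × H)}
    (hB : IsCanonicalExtension A B) {x₀ : ℂ} {u : H} (hu : u ∈ relKer B x₀) (hu0 : u ≠ 0)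
    {η ω : H} (hx : (η, ω) ∈ B) : ∃ c : ℂ, (η - c • u, ω - c • x₀ • u) ∈ A.graph := by
  obtain ⟨p, hp, h⟩ := hA.exists_generator hB
  obtain ⟨c₀, h₀⟩ := h _ (mem_relKer.1 hu)
  obtain ⟨c, hc⟩ := h _ hx
  have hc0 : c₀ ≠ 0 := by
    rintro rfl
    rw [zero_smul, sub_zero, ← mem_relKer, hA.relKer_graph] at h₀
    exact hu0 h₀
  refine ⟨c / c₀, ?_⟩
  have h1 := sub_mem hc (Submodule.smul_mem _ (c / c₀) h₀)
  rw [smul_sub, smul_smul, div_mul_cancel₀ _ hc0, sub_sub_sub_cancel_right] at h1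
  exact h1

theorem IsClassS.exists_eigenvector (hA : IsClassS A) {B : Submodule ℂ (H × H)}
    (hB : IsCanonicalExtension A B) {x₀ : ℂ} (hx₀ : x₀ ∈ relSpectrum B) :
    ∃ u ∈ relKer B x₀, u ≠ 0 := by
  by_contra! h
  have hker : relKer B x₀ = ⊥ := (Submodule.eq_bot_iff _).2 h
  refine hx₀ (exists_isResolventAt hB.2 ?_ hker (by rwa [conj_eq_of_mem_relSpectrum hB.2 hx₀]))
  obtain ⟨p, hp, hgen⟩ := hA.exists_generator hB
  have h1 : B = A.graph ⊔ Submodule.span ℂ {p} :=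
    le_antisymm (fun x hx => mem_sup_span_singleton.2 (hgen x hx))
      (sup_le hB.1 (by simpa using hp))
  rw [h1, shiftRange, Submodule.map_sup, Submodule.map_span]
  have : FiniteDimensional ℂ (Submodule.span ℂ
      ((LinearMap.snd ℂ H H - x₀ • LinearMap.fst ℂ H H) '' {p})) :=
    FiniteDimensional.span_of_finite _ ((Set.finite_singleton p).image _)
  exact Submodule.isClosed_sup_finiteDimensional _ _ (hA.isClosed_shiftRange x₀)

/-- Near an eigenvalue `x₀` of `B`, the relation `B - zI` is bounded below by `|z - x₀|`. On the
orthogonal complement of an eigenvector, the regularity of `A` at `x₀` gives a lower bound for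
`B - x₀I`, because each element of `B` differs from one of `A` by a multiple of the eigenvector. -/
theorem IsClassS.exists_isBoundedBelowAt_near (hA : IsClassS A) {B : Submodule ℂ (H × H)}
    (hB : IsCanonicalExtension A B) {x₀ : ℂ} (hx₀ : x₀ ∈ relSpectrum B) :
    ∃ δ, 0 < δ ∧ ∀ z, ‖z - x₀‖ < δ → IsBoundedBelowAt B z ‖z - x₀‖ := by
  obtain ⟨u, hu, hu0⟩ := hA.exists_eigenvector hB hx₀
  obtain ⟨d, hd, hbd⟩ := hA.exists_isBoundedBelowAt x₀
  have hreal := conj_eq_of_mem_relSpectrum hB.2 hx₀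
  refine ⟨d / 2, by positivity, fun z hz η ω hx => ?_⟩
  set t : ℂ := inner ℂ u η / inner ℂ u u with ht
  set η' := η - t • u with hη'
  set ω' := ω - t • x₀ • u with hω'
  have hx' : (η', ω') ∈ B := sub_mem hx (Submodule.smul_mem _ t hu)
  have horth : inner ℂ u η' = 0 := by
    rw [hη', inner_sub_right, inner_smul_right, ht,
      div_mul_cancel₀ _ (inner_self_ne_zero.2 hu0), sub_self]
  have horth' : inner ℂ u ω' = 0 := by
    rw [← mem_adjoint_iff_inner.1 (hB.2.ge hx') _ _ (mem_relKer.1 hu), inner_smul_left, horth,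
      mul_zero]
  -- the lower bound at `x₀` on the orthogonal complement of `u`
  have h1 : d * ‖η'‖ ≤ ‖ω' - x₀ • η'‖ := by
    obtain ⟨c, hc⟩ := hA.exists_sub_smul_eigenvector_mem hB hu hu0 hx'
    have h2 := hbd _ _ hc
    have h3 : ω' - c • x₀ • u - x₀ • (η' - c • u) = ω' - x₀ • η' := by
      rw [smul_sub, smul_comm c x₀]; abel
    rw [h3] at h2
    refine le_trans (mul_le_mul_of_nonneg_left ?_ hd.le) h2
    have h4 : ‖η' - c • u‖ ^ 2 = ‖η'‖ ^ 2 + ‖c • u‖ ^ 2 := by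
      have h5 : inner ℂ η' (c • u) = 0 := by
        rw [inner_smul_right, inner_eq_zero_symm.1 horth, mul_zero]
      rw [@norm_sub_sq ℂ, h5]
      simp
    exact (sq_le_sq₀ (norm_nonneg _) (norm_nonneg _)).1 (by rw [h4]; linarith [sq_nonneg ‖c • u‖])
  have h2 : ‖z - x₀‖ * ‖η'‖ ≤ ‖ω' - z • η'‖ := by
    have h3 : ω' - x₀ • η' = (ω' - z • η') + (z - x₀) • η' := by module
    have h4 := norm_add_le (ω' - z • η') ((z - x₀) • η')
    rw [← h3, norm_smul] at h4
    have h5 : ‖z - x₀‖ * ‖η'‖ ≤ d / 2 * ‖η'‖ := by gcongr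
    linarith
  -- both sides split orthogonally along `u`
  have h3 : ω - z • η = (ω' - z • η') + (t * (x₀ - z)) • u := by
    rw [hω', hη']; module
  have h4 : η = η' + t • u := by rw [hη', sub_add_cancel]
  have h5 : ‖η‖ ^ 2 = ‖η'‖ ^ 2 + ‖t • u‖ ^ 2 := by
    have h6 : inner ℂ η' (t • u) = 0 := by
      rw [inner_smul_right, inner_eq_zero_symm.1 horth, mul_zero]
    conv_lhs => rw [h4]
    rw [@norm_add_sq ℂ, h6]
    simp
  have h6 : ‖ω - z • η‖ ^ 2 = ‖ω' - z • η'‖ ^ 2 + ‖(t * (x₀ - z)) • u‖ ^ 2 := by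
    have h7 : inner ℂ (ω' - z • η') ((t * (x₀ - z)) • u) = 0 := by
      rw [inner_smul_right, inner_sub_left, inner_smul_left, inner_eq_zero_symm.1 horth,
        inner_eq_zero_symm.1 horth', mul_zero, sub_zero, mul_zero]
    rw [h3, @norm_add_sq ℂ, h7]
    simp
  refine (sq_le_sq₀ (by positivity) (norm_nonneg _)).1 ?_
  rw [mul_pow, h5, h6, mul_add, ← mul_pow, ← mul_pow]
  have h8 : ‖(t * (x₀ - z)) • u‖ = ‖z - x₀‖ * ‖t • u‖ := by
    rw [norm_smul, norm_smul, norm_mul, norm_sub_rev]; ring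
  rw [h8]
  gcongr

/-- Near a point `x₀` of the spectrum of `B` there is no other point of the spectrum, and the
resolvent is bounded by `1 / |z - x₀|`. -/
theorem IsClassS.exists_norm_relResolvent_le (hA : IsClassS A) {B : Submodule ℂ (H × H)}
    (hB : IsCanonicalExtension A B) {x₀ : ℂ} (hx₀ : x₀ ∈ relSpectrum B) :
    ∃ δ, 0 < δ ∧ ∀ z, z ≠ x₀ → ‖z - x₀‖ < δ →
      z ∉ relSpectrum B ∧ ‖relResolvent B z‖ ≤ ‖z - x₀‖⁻¹ := by
  obtain ⟨δ, hδ, h⟩ := hA.exists_isBoundedBelowAt_near hB hx₀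
  refine ⟨δ, hδ, fun z hz hzδ => ?_⟩
  have hpos : 0 < ‖z - x₀‖ := norm_pos_iff.2 (sub_ne_zero.2 hz)
  have hconj : ‖conj z - x₀‖ = ‖z - x₀‖ := by
    rw [← norm_conj (z - x₀), map_sub, conj_eq_of_mem_relSpectrum hB.2 hx₀]
  obtain ⟨R, hR⟩ := exists_isResolventAt_of_isBoundedBelowAt hB.2 hpos (h z hzδ)
    (hconj ▸ hpos) (h (conj z) (hconj ▸ hzδ))
  refine ⟨hR.notMem_relSpectrum, ?_⟩
  rw [hR.relResolvent_eq]
  exact hR.norm_le hpos (h z hzδ)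

/-- The spectrum of a canonical selfadjoint extension has no accumulation points. -/
theorem IsClassS.eventually_notMem_relSpectrum (hA : IsClassS A) {B : Submodule ℂ (H × H)}
    (hB : IsCanonicalExtension A B) (x : ℂ) : ∀ᶠ z in 𝓝[≠] x, z ∉ relSpectrum B := by
  by_cases hx : x ∈ relSpectrum B
  · obtain ⟨δ, hδ, h⟩ := hA.exists_norm_relResolvent_le hB hx
    filter_upwards [self_mem_nhdsWithin, mem_nhdsWithin_of_mem_nhds (Metric.ball_mem_nhds x hδ)]
      with z hz hzδ
    exact (h z hz (by simpa [dist_eq_norm] using hzδ)).1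
  · exact mem_nhdsWithin_of_mem_nhds ((isOpen_compl_relSpectrum B).mem_nhds hx)

theorem IsClassS.exists_real_notMem_relSpectrum (hA : IsClassS A) {B : Submodule ℂ (H × H)}
    (hB : IsCanonicalExtension A B) : ∃ v : ℝ, (v : ℂ) ∉ relSpectrum B := by
  have h1 : Tendsto (fun x : ℝ => (x : ℂ)) (𝓝[≠] 0) (𝓝[≠] 0) :=
    (continuous_ofReal.tendsto' 0 0 ofReal_zero).inf (tendsto_principal_principal.2 (by simp))
  exact (h1.eventually (hA.eventually_notMem_relSpectrum hB 0)).exists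

end Extensions

/-! ### Symmetric operators without approximate eigenvalues -/

section ApproximateEigenvalues

variable {H : Type*} [NormedAddCommGroup H] [InnerProductSpace ℂ H]

/-- A bounded operator that is symmetric on an invariant subspace `M`, and has no nonzero real
approximate eigenvalue there, vanishes on `M`. If `λ > 0` is the norm of the restriction, then
`‖K²φ - λ²φ‖² ≤ λ⁴‖φ‖² - λ²‖Kφ‖²`, so that a lower bound for `(K - λ)(K + λ)` makes the norm of
the restriction smaller than `λ`. -/
theorem eq_zero_of_no_approximate_eigenvalue {K : H →L[ℂ] H} {M : Submodule ℂ H}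
    (hM : ∀ φ ∈ M, K φ ∈ M) (hK : ∀ φ ∈ M, ∀ η ∈ M, inner ℂ (K φ) η = inner ℂ φ (K η))
    (hlow : ∀ μ : ℝ, μ ≠ 0 → ∃ c, 0 < c ∧ ∀ φ ∈ M, c * ‖φ‖ ≤ ‖K φ - (μ : ℂ) • φ‖)
    {φ : H} (hφ : φ ∈ M) : K φ = 0 := by
  set T : M →L[ℂ] H := K.comp M.subtypeL with hT
  have hTle : ∀ φ ∈ M, ‖K φ‖ ≤ ‖T‖ * ‖φ‖ := fun φ hφ => T.le_opNorm ⟨φ, hφ⟩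
  rcases (norm_nonneg T).eq_or_lt with h0 | h0
  · have := hTle φ hφ
    rw [← h0, zero_mul] at this
    exact norm_le_zero_iff.1 this
  · exfalso
    set l := ‖T‖ with hl
    obtain ⟨c₁, hc₁, h₁⟩ := hlow l h0.ne'
    obtain ⟨c₂, hc₂, h₂⟩ := hlow (-l) (neg_ne_zero.2 h0.ne')
    set ε := c₁ * c₂ / l with hε
    have hεpos : 0 < ε := by positivity
    have key : ∀ φ ∈ M, ‖K φ‖ ^ 2 ≤ (l ^ 2 - ε ^ 2) * ‖φ‖ ^ 2 := by
      intro φ hφ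
      have hφ' : K φ + (l : ℂ) • φ ∈ M := add_mem (hM φ hφ) (M.smul_mem _ hφ)
      have e1 := h₂ φ hφ
      rw [ofReal_neg, neg_smul, sub_neg_eq_add] at e1
      have e2 := h₁ _ hφ'
      have e3 : K (K φ + (l : ℂ) • φ) - (l : ℂ) • (K φ + (l : ℂ) • φ) =
          K (K φ) - ((l ^ 2 : ℝ) : ℂ) • φ := by
        rw [map_add, map_smul, ofReal_pow]
        module
      rw [e3] at e2
      have e4 : c₁ * c₂ * ‖φ‖ ≤ ‖K (K φ) - ((l ^ 2 : ℝ) : ℂ) • φ‖ := by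
        refine le_trans ?_ e2
        rw [mul_assoc]
        gcongr
      have e5 : ‖K (K φ) - ((l ^ 2 : ℝ) : ℂ) • φ‖ ^ 2 =
          ‖K (K φ)‖ ^ 2 - 2 * l ^ 2 * ‖K φ‖ ^ 2 + l ^ 4 * ‖φ‖ ^ 2 := by
        have hin : inner ℂ (K (K φ)) (((l ^ 2 : ℝ) : ℂ) • φ) = ((l ^ 2 * ‖K φ‖ ^ 2 : ℝ) : ℂ) := by
          rw [inner_smul_right, hK _ (hM φ hφ) _ hφ, inner_self_eq_norm_sq_to_K, ofReal_mul,
            ofReal_pow ‖K φ‖ 2]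
          rfl
        rw [@norm_sub_sq ℂ, hin, norm_smul, norm_real, Real.norm_of_nonneg (by positivity)]
        change ‖K (K φ)‖ ^ 2 - 2 * (l ^ 2 * ‖K φ‖ ^ 2) + (l ^ 2 * ‖φ‖) ^ 2 = _
        ring
      have e6 : ‖K (K φ)‖ ^ 2 ≤ l ^ 2 * ‖K φ‖ ^ 2 := by
        rw [← mul_pow]
        exact pow_le_pow_left₀ (norm_nonneg _) (hTle _ (hM φ hφ)) 2
      have e7 : (c₁ * c₂ * ‖φ‖) ^ 2 ≤ ‖K (K φ) - ((l ^ 2 : ℝ) : ℂ) • φ‖ ^ 2 :=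
        pow_le_pow_left₀ (by positivity) e4 2
      have e8 : c₁ * c₂ = ε * l := by rw [hε, div_mul_cancel₀ _ h0.ne']
      rw [e5, e8] at e7
      have e9 : l ^ 2 * ‖K φ‖ ^ 2 ≤ l ^ 2 * ((l ^ 2 - ε ^ 2) * ‖φ‖ ^ 2) := by nlinarith
      exact le_of_mul_le_mul_left e9 (by positivity)
    have h3 : l ≤ √(max (l ^ 2 - ε ^ 2) 0) := by
      refine T.opNorm_le_bound (Real.sqrt_nonneg _) fun φ => ?_
      refine (sq_le_sq₀ (norm_nonneg _) (by positivity)).1 ?_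
      rw [mul_pow, Real.sq_sqrt (le_max_right _ _)]
      refine (key φ φ.2).trans ?_
      gcongr
      · exact le_max_left _ _
      · exact le_rfl
    have h4 : l ^ 2 ≤ max (l ^ 2 - ε ^ 2) 0 := by
      rw [← Real.sq_sqrt (le_max_right (l ^ 2 - ε ^ 2) 0)]
      exact pow_le_pow_left₀ h0.le h3 2
    rcases le_max_iff.1 h4 with h5 | h5
    · have : 0 < ε ^ 2 := by positivity
      linarith
    · have : 0 < l ^ 2 := by positivity
      linarith

end ApproximateEigenvalues

/-! ### Deficiency spaces -/

section Deficiency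

variable {H : Type*} [NormedAddCommGroup H] [InnerProductSpace ℂ H]
  {A : H →ₗ.[ℂ] H} {B : Submodule ℂ (H × H)}

/-- The vector `[I + (z - w)(B - zI)⁻¹] η`, which lies in the deficiency space at `z` if `η` lies
in the deficiency space at `w`. -/
noncomputable def deficiencyTransfer (B : Submodule ℂ (H × H)) (w z : ℂ) (η : H) : H :=
  η + (z - w) • relResolvent B z η

theorem deficiencyTransfer_self (w : ℂ) (η : H) : deficiencyTransfer B w w η = η := by
  simp [deficiencyTransfer]

theorem deficiencyTransfer_smul (w z c : ℂ) (η : H) :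
    deficiencyTransfer B w z (c • η) = c • deficiencyTransfer B w z η := by
  rw [deficiencyTransfer, deficiencyTransfer, map_smul, smul_add, smul_comm c]

theorem relResolvent_deficiencyTransfer {w z : ℂ} (hw : w ∉ relSpectrum B)
    (hz : z ∉ relSpectrum B) (η : H) :
    relResolvent B w (deficiencyTransfer B w z η) = relResolvent B z η := by
  have h := (isResolventAt_relResolvent hw).sub_eq (isResolventAt_relResolvent hz) η
  rw [deficiencyTransfer, map_add, map_smul, ← neg_sub w z, neg_smul, ← h]
  abel

theorem deficiencyTransfer_deficiencyTransfer {w z : ℂ} (hw : w ∉ relSpectrum B)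
    (hz : z ∉ relSpectrum B) (η : H) :
    deficiencyTransfer B z w (deficiencyTransfer B w z η) = η := by
  rw [deficiencyTransfer, relResolvent_deficiencyTransfer hw hz, deficiencyTransfer]
  module

theorem deficiencyTransfer_ne_zero {w z : ℂ} (hw : w ∉ relSpectrum B) (hz : z ∉ relSpectrum B)
    {η : H} (hη : η ≠ 0) : deficiencyTransfer B w z η ≠ 0 := by
  intro h
  have h1 := deficiencyTransfer_deficiencyTransfer hw hz η
  rw [h] at h1
  exact hη (by rw [← h1]; simp [deficiencyTransfer])

variable [CompleteSpace H]

theorem differentiableAt_deficiencyTransfer {w z : ℂ} (hz : z ∉ relSpectrum B) (η : H) :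
    DifferentiableAt ℂ (fun z => deficiencyTransfer B w z η) z := by
  have h1 : DifferentiableAt ℂ (fun z => relResolvent B z η) z :=
    (differentiableAt_relResolvent hz).clm_apply (differentiableAt_const η)
  unfold deficiencyTransfer
  fun_prop

theorem IsCanonicalExtension.deficiencyTransfer_mem (hB : IsCanonicalExtension A B) {w z : ℂ}
    (hz : z ∉ relSpectrum B) {η : H} (hη : η ∈ relKer A.graph.adjoint w) :
    deficiencyTransfer B w z η ∈ relKer A.graph.adjoint z := by
  rw [mem_relKer_adjoint]
  intro a b hab
  have h1 := (isResolventAt_relResolvent (conj_notMem_relSpectrum hB.2 hz)).apply (hB.1 hab)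
  have h2 := inner_relResolvent_left hB.2 (conj_notMem_relSpectrum hB.2 hz) (b - conj z • a) η
  rw [conj_conj, h1] at h2
  have h3 := mem_relKer_adjoint.1 hη a b hab
  rw [inner_sub_left, inner_smul_left, conj_conj] at h3
  rw [deficiencyTransfer, inner_add_right, inner_smul_right, ← h2, inner_sub_left, inner_smul_left,
    conj_conj]
  linear_combination h3

theorem IsClassS.finrank_relKer_adjoint (hA : IsClassS A) (hB : IsCanonicalExtension A B) {z : ℂ}
    (hz : z ∉ relSpectrum B) : Module.finrank ℂ (relKer A.graph.adjoint z) = 1 := by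
  have hI : I ∉ relSpectrum B := notMem_relSpectrum_of_im_ne_zero hB.2 (by simp)
  obtain ⟨⟨e, he⟩, he0, hspan⟩ := finrank_eq_one_iff'.1 hA.deficiency_upper
  have he0' : e ≠ 0 := fun h => he0 (Subtype.ext h)
  refine finrank_eq_one_iff'.2 ⟨⟨_, hB.deficiencyTransfer_mem hz he⟩,
    fun h => deficiencyTransfer_ne_zero hI hz he0' (congrArg Subtype.val h), ?_⟩
  rintro ⟨η, hη⟩
  obtain ⟨c, hc⟩ := hspan ⟨_, hB.deficiencyTransfer_mem hI hη⟩
  refine ⟨c, Subtype.ext ?_⟩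
  have hc' : c • e = deficiencyTransfer B z I η := congrArg Subtype.val hc
  change c • deficiencyTransfer B I z e = η
  rw [← deficiencyTransfer_smul, hc', deficiencyTransfer_deficiencyTransfer hz hI]

/-- The elements `(η, ω)` of `B` with `ω - vη` orthogonal to a deficiency vector at the real point
`v` are those of the graph of `A`. -/
theorem IsClassS.mem_graph_of_inner_eq_zero (hA : IsClassS A) (hB : IsCanonicalExtension A B)
    {v : ℝ} (hv : (v : ℂ) ∉ relSpectrum B) {ψ : H} (hψ : ψ ∈ relKer A.graph.adjoint (v : ℂ))
    (hψ0 : ψ ≠ 0) {η ω : H} (hx : (η, ω) ∈ B) (h : inner ℂ ψ (ω - (v : ℂ) • η) = 0) :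
    (η, ω) ∈ A.graph := by
  have h1 : ω - (v : ℂ) • η ∈ shiftRange A.graph v :=
    hA.mem_shiftRange_of_inner_eq_zero (by rw [conj_ofReal]; exact hA.finrank_relKer_adjoint hB hv)
      (by rwa [conj_ofReal]) hψ0 h
  obtain ⟨a, b, hab, hu⟩ := mem_shiftRange.1 h1
  have hR := isResolventAt_relResolvent hv
  have h2 := hR.apply hx
  have h3 := hR.apply (hB.1 hab)
  rw [hu, h2] at h3
  subst h3
  rwa [sub_left_inj.1 hu] at hab

/-! ### Completeness of the deficiency vectors -/

/-- The deficiency spaces of `A` at nonreal points span a dense subspace. The part of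
`A` in their common orthogonal complement is a selfadjoint operator without spectrum, since `A` is
regular, so the complement is zero. -/
theorem IsClassS.eq_zero_of_forall_inner_eq_zero (hA : IsClassS A)
    (hB : IsCanonicalExtension A B) {φ : H}
    (hφ : ∀ z : ℂ, z.im ≠ 0 → ∀ η ∈ relKer A.graph.adjoint z, inner ℂ η φ = 0) : φ = 0 := by
  obtain ⟨v, hv⟩ := hA.exists_real_notMem_relSpectrum hB
  set K := relResolvent B (v : ℂ) with hKdef
  have hR : IsResolventAt B v K := isResolventAt_relResolvent hv
  have hKs : ∀ x y, inner ℂ (K x) y = inner ℂ x (K y) := fun x y => by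
    have := inner_relResolvent_left hB.2 hv x y
    rwa [conj_ofReal] at this
  set M : Submodule ℂ H :=
    ⨅ z : {z : ℂ // z.im ≠ 0}, (relKer A.graph.adjoint (z : ℂ))ᗮ with hMdef
  have memM : ∀ {φ}, φ ∈ M ↔
      ∀ z : ℂ, z.im ≠ 0 → ∀ η ∈ relKer A.graph.adjoint z, inner ℂ η φ = 0 := by
    simp [hMdef, Submodule.mem_iInf, Submodule.mem_orthogonal]
  -- the elements of `M` are orthogonal to the deficiency space at `v`, too
  have hMv : ∀ φ ∈ M, ∀ η ∈ relKer A.graph.adjoint (v : ℂ), inner ℂ η φ = 0 := by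
    intro φ hφ η hη
    have h1 : ContinuousAt (fun z => inner ℂ (deficiencyTransfer B v z η) φ) (v : ℂ) :=
      (differentiableAt_deficiencyTransfer hv η).continuousAt.inner continuousAt_const
    have h2 : Tendsto (fun t : ℝ => (v : ℂ) + t * I) (𝓝[≠] 0) (𝓝 v) := by
      have : Continuous fun t : ℝ => (v : ℂ) + t * I := by fun_prop
      exact (this.tendsto' 0 _ (by simp)).mono_left nhdsWithin_le_nhds
    have h3 : ∀ᶠ t : ℝ in 𝓝[≠] 0,
        inner ℂ (deficiencyTransfer B v ((v : ℂ) + t * I) η) φ = 0 := by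
      filter_upwards [self_mem_nhdsWithin] with t ht
      have him : ((v : ℂ) + t * I).im ≠ 0 := by simpa using ht
      exact memM.1 hφ _ him _
        (hB.deficiencyTransfer_mem (notMem_relSpectrum_of_im_ne_zero hB.2 him) hη)
    have h4 := tendsto_nhds_unique (h1.tendsto.comp h2) (tendsto_const_nhds.congr' (by
      filter_upwards [h3] with t ht using ht.symm))
    rwa [deficiencyTransfer_self] at h4
  have hMK : ∀ φ ∈ M, K φ ∈ M := by
    intro φ hφ
    refine memM.2 fun z hz η hη => ?_
    have h1 := hMv φ hφ _ (hB.deficiencyTransfer_mem hv hη)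
    have h2 := memM.1 hφ z hz η hη
    rw [deficiencyTransfer, inner_add_left, h2, zero_add, inner_smul_left, mul_eq_zero] at h1
    rw [← hKs]
    refine h1.resolve_left ?_
    rw [map_eq_zero, sub_eq_zero]
    rintro rfl
    exact hz (ofReal_im v)
  have hMA : ∀ φ ∈ M, (K φ, φ + (v : ℂ) • K φ) ∈ A.graph := by
    intro φ hφ
    obtain ⟨⟨ψ, hψ⟩, hψ0, -⟩ := finrank_eq_one_iff'.1 (hA.finrank_relKer_adjoint hB hv)
    refine hA.mem_graph_of_inner_eq_zero hB hv hψ (fun h => hψ0 (Subtype.ext h)) (hR.mem φ) ?_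
    rw [add_sub_cancel_right]
    exact hMv φ hφ ψ hψ
  have hlow : ∀ μ : ℝ, μ ≠ 0 → ∃ c, 0 < c ∧ ∀ φ ∈ M, c * ‖φ‖ ≤ ‖K φ - (μ : ℂ) • φ‖ := by
    intro μ hμ
    -- an approximate eigenvalue `μ` of `K` would be an approximate eigenvalue `v + 1 / μ` of `A`
    obtain ⟨d, hd, hbd⟩ := hA.exists_isBoundedBelowAt ((v : ℂ) + (μ : ℂ)⁻¹)
    have hμ' : (μ : ℂ) ≠ 0 := ofReal_ne_zero.2 hμ
    have hμ0 : 0 < |μ| := abs_pos.2 hμ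
    refine ⟨|μ| * (1 + (|μ| * d)⁻¹)⁻¹, by positivity, fun φ hφ => ?_⟩
    have h1 := hbd _ _ (hMA φ hφ)
    have h2 : φ + (v : ℂ) • K φ - ((v : ℂ) + (μ : ℂ)⁻¹) • K φ = φ - (μ : ℂ)⁻¹ • K φ := by module
    rw [h2] at h1
    have h3 : K φ - (μ : ℂ) • φ = -((μ : ℂ) • (φ - (μ : ℂ)⁻¹ • K φ)) := by
      rw [smul_sub, smul_smul, mul_inv_cancel₀ hμ', one_smul, neg_sub]
    rw [h3, norm_neg, norm_smul, norm_real, Real.norm_eq_abs, mul_assoc]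
    refine mul_le_mul_of_nonneg_left ?_ hμ0.le
    rw [inv_mul_le_iff₀ (by positivity)]
    have h4 : ‖φ‖ ≤ ‖φ - (μ : ℂ)⁻¹ • K φ‖ + |μ|⁻¹ * ‖K φ‖ := by
      have := norm_add_le (φ - (μ : ℂ)⁻¹ • K φ) ((μ : ℂ)⁻¹ • K φ)
      rwa [sub_add_cancel, norm_smul, norm_inv, norm_real, Real.norm_eq_abs] at this
    have h5 : ‖K φ‖ ≤ d⁻¹ * ‖φ - (μ : ℂ)⁻¹ • K φ‖ := by
      rwa [inv_mul_eq_div, le_div_iff₀' hd]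
    calc ‖φ‖ ≤ ‖φ - (μ : ℂ)⁻¹ • K φ‖ + |μ|⁻¹ * (d⁻¹ * ‖φ - (μ : ℂ)⁻¹ • K φ‖) :=
          h4.trans (by gcongr)
      _ = (1 + (|μ| * d)⁻¹) * ‖φ - (μ : ℂ)⁻¹ • K φ‖ := by rw [mul_inv]; ring
  have hK0 : K φ = 0 := eq_zero_of_no_approximate_eigenvalue hMK (fun x _ y _ => hKs x y) hlow
    (memM.2 hφ)
  have h1 := hMA φ (memM.2 hφ)
  rw [hK0, smul_zero, add_zero] at h1
  exact A.graph_fst_eq_zero_snd h1 rfl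

end Deficiency

/-! ### Involutions -/

section Involutions

variable {H : Type*} [NormedAddCommGroup H] [InnerProductSpace ℂ H]
  {A : H →ₗ.[ℂ] H} {B : Submodule ℂ (H × H)} {J : H →ₗᵢ⋆[ℂ] H}

theorem inner_antilinear_isometry (J : H →ₗᵢ⋆[ℂ] H) (x y : H) :
    inner ℂ (J x) (J y) = inner ℂ y x := by
  have h1 : ‖J x - I • J y‖ = ‖x + I • y‖ := by
    rw [← J.norm_map (x + I • y), map_add, map_smulₛₗ, conj_I, neg_smul, sub_eq_add_neg]
  have h2 : ‖J x + I • J y‖ = ‖x - I • y‖ := by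
    rw [← J.norm_map (x - I • y), map_sub, map_smulₛₗ, conj_I, neg_smul, sub_neg_eq_add]
  have h3 : ‖y - I • x‖ = ‖x + I • y‖ := by
    have : x + I • y = I • (y - I • x) := by
      rw [smul_sub, smul_smul, I_mul_I]; module
    rw [this, norm_smul, norm_I, one_mul]
  have h4 : ‖y + I • x‖ = ‖x - I • y‖ := by
    have : x - I • y = -(I • (y + I • x)) := by
      rw [smul_add, smul_smul, I_mul_I]; module
    rw [this, norm_neg, norm_smul, norm_I, one_mul]
  rw [inner_eq_sum_norm_sq_div_four (J x), inner_eq_sum_norm_sq_div_four y]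
  have h5 : ‖J x + J y‖ = ‖y + x‖ := by rw [← map_add, J.norm_map, add_comm]
  have h6 : ‖J x - J y‖ = ‖y - x‖ := by rw [← map_sub, J.norm_map, norm_sub_rev]
  have hI : (RCLike.I : ℂ) = I := rfl
  rw [hI, h1, h2, h3, h4, h5, h6]

theorem inner_involution_right (hJ : ∀ x, J (J x) = x) (x y : H) :
    inner ℂ x (J y) = inner ℂ y (J x) := by
  rw [← inner_antilinear_isometry J, hJ]

theorem map_mem_relKer_adjoint (hJ : ∀ x, J (J x) = x) {G : Submodule ℂ (H × H)}
    (hG : ∀ a b, (a, b) ∈ G → (J a, J b) ∈ G) {z : ℂ} {η : H} (hη : η ∈ relKer G.adjoint z) :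
    J η ∈ relKer G.adjoint (conj z) := by
  rw [mem_relKer_adjoint]
  intro a b hab
  rw [conj_conj, inner_involution_right hJ, map_sub, map_smulₛₗ,
    inner_eq_zero_symm.1 (mem_relKer_adjoint.1 hη _ _ (hG a b hab))]

theorem exists_real_vector (hJ : ∀ x, J (J x) = x) {N : Submodule ℂ H}
    (hN : ∀ η ∈ N, J η ∈ N) (hN0 : N ≠ ⊥) : ∃ ψ ∈ N, ψ ≠ 0 ∧ J ψ = ψ := by
  obtain ⟨η, hη, hη0⟩ := N.exists_mem_ne_zero_of_ne_bot hN0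
  by_cases h : η + J η = 0
  · refine ⟨I • η, N.smul_mem _ hη, smul_ne_zero I_ne_zero hη0, ?_⟩
    rw [map_smulₛₗ, conj_I, ← neg_eq_of_add_eq_zero_right h, smul_neg, neg_smul, neg_neg]
  · exact ⟨_, N.add_mem hη (hN η hη), h, by rw [map_add, hJ, add_comm]⟩

theorem relResolvent_comm {z w : ℂ} (hz : z ∉ relSpectrum B) (hw : w ∉ relSpectrum B) (x : H) :
    relResolvent B z (relResolvent B w x) = relResolvent B w (relResolvent B z x) := by
  rcases eq_or_ne z w with rfl | hne
  · rfl
  · have hR := isResolventAt_relResolvent hz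
    have hS := isResolventAt_relResolvent hw
    have h1 := hR.sub_eq hS x
    have h2 := hS.sub_eq hR x
    rw [← neg_sub, h2, ← neg_smul, neg_sub] at h1
    exact (smul_right_injective H (sub_ne_zero.2 hne) h1).symm

variable [CompleteSpace H]

theorem IsCommutingInvolution.map_mem_extension (hJ : IsCommutingInvolution A J)
    (hB : IsCanonicalExtension A B) {a b : H} (h : (a, b) ∈ B) : (J a, J b) ∈ B := by
  have hI : I ∉ relSpectrum B := notMem_relSpectrum_of_im_ne_zero hB.2 (by simp)
  have h1 := hJ.commutes B hB I (by simp) (b - I • a)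
  rw [(isResolventAt_relResolvent hI).apply h, map_sub, map_smulₛₗ] at h1
  have h2 := (isResolventAt_relResolvent (conj_notMem_relSpectrum hB.2 hI)).mem
    (J b - conj I • J a)
  rwa [← h1, sub_add_cancel] at h2

/-- An involution that commutes with all canonical selfadjoint extensions of `A` leaves the graph
of `A` invariant. -/
theorem IsCommutingInvolution.map_mem_graph (hA : IsClassS A) (hJ : IsCommutingInvolution A J)
    (a b : H) (h : (a, b) ∈ A.graph) : (J a, J b) ∈ A.graph := by
  obtain ⟨B, B', hB, hB', hle⟩ := hA.exists_extensions_inf_le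
  exact hle ⟨hJ.map_mem_extension hB (hB.1 h), hJ.map_mem_extension hB' (hB'.1 h)⟩

theorem isCommutingInvolution_of_map_mem (hJ : ∀ x, J (J x) = x)
    (h : ∀ B, IsCanonicalExtension A B → ∀ a b, (a, b) ∈ B → (J a, J b) ∈ B) :
    IsCommutingInvolution A J := by
  refine ⟨hJ, fun B hB z hz φ => ?_⟩
  have hz' := notMem_relSpectrum_of_im_ne_zero hB.2 hz
  have h1 := h B hB _ _ ((isResolventAt_relResolvent hz').mem φ)
  have h2 := (isResolventAt_relResolvent (conj_notMem_relSpectrum hB.2 hz')).apply h1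
  rwa [map_add, map_smulₛₗ, add_sub_cancel_right, eq_comm] at h2

/-- Every element of `A*` is, modulo the graph of `A`, a linear combination of `(p, ψ + vp)` with
`p = (B - vI)⁻¹ ψ`, which spans `B` modulo the graph of `A`, and of `(ψ, vψ)`. -/
theorem IsClassS.exists_adjoint_decomposition (hA : IsClassS A) (hB : IsCanonicalExtension A B)
    {v : ℝ} (hv : (v : ℂ) ∉ relSpectrum B) {ψ : H} (hψ : ψ ∈ relKer A.graph.adjoint (v : ℂ))
    (hψ0 : ψ ≠ 0) {η ω : H} (hx : (η, ω) ∈ A.graph.adjoint) :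
    ∃ α β : ℂ, (η - (α • relResolvent B v ψ + β • ψ),
      ω - (α • (ψ + (v : ℂ) • relResolvent B v ψ) + β • (v : ℂ) • ψ)) ∈ A.graph := by
  have hR := isResolventAt_relResolvent hv
  set R := relResolvent B (v : ℂ)
  set u := ω - (v : ℂ) • η with hu
  have h1 : η - R u ∈ relKer A.graph.adjoint (v : ℂ) := by
    have h2 := sub_mem hx (hB.le_adjoint (hR.mem u))
    have h3 : (η, ω) - (R u, u + (v : ℂ) • R u) = (η - R u, (v : ℂ) • (η - R u)) := by
      refine Prod.ext rfl ?_
      change ω - (u + (v : ℂ) • R u) = (v : ℂ) • (η - R u)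
      rw [hu]
      module
    rw [h3] at h2
    exact h2
  obtain ⟨β, hβ⟩ := (finrank_eq_one_iff_of_nonzero'
    (⟨ψ, hψ⟩ : relKer A.graph.adjoint (v : ℂ)) (by simpa using hψ0)).1
    (hA.finrank_relKer_adjoint hB hv) ⟨_, h1⟩
  have hβ' : β • ψ = η - R u := congrArg Subtype.val hβ
  set α : ℂ := inner ℂ ψ u / inner ℂ ψ ψ with hα
  refine ⟨α, β, ?_⟩
  have h4 := hA.mem_graph_of_inner_eq_zero hB hv hψ hψ0 (hR.mem (u - α • ψ)) (by
    rw [add_sub_cancel_right, inner_sub_right, inner_smul_right, hα,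
      div_mul_cancel₀ _ (inner_self_ne_zero.2 hψ0), sub_self])
  convert h4 using 2
  · rw [map_sub, map_smul, hβ']
    abel
  · rw [map_sub, map_smul, smul_comm β, hβ', eq_add_of_sub_eq hu.symm]
    module

/-- An involution that commutes with the resolvent of one canonical selfadjoint extension `B` at a
real point `v`, and fixes a deficiency vector at `v`, commutes with all canonical selfadjoint
extensions: modulo the graph of `A`, such an extension is spanned by
`α (p, ψ + vp) + β (ψ, vψ)` where the quotient of `α` and `β` is real since the boundary form
vanishes on it. -/
theorem IsClassS.isCommutingInvolution (hA : IsClassS A) (hB : IsCanonicalExtension A B)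
    {v : ℝ} (hv : (v : ℂ) ∉ relSpectrum B) {ψ : H} (hψ : ψ ∈ relKer A.graph.adjoint (v : ℂ))
    (hψ0 : ψ ≠ 0) (hJ : ∀ x, J (J x) = x) (hJψ : J ψ = ψ)
    (hJR : ∀ x, J (relResolvent B v x) = relResolvent B v (J x)) :
    IsCommutingInvolution A J := by
  have hR := isResolventAt_relResolvent hv
  have hJB : ∀ a b, (a, b) ∈ B → (J a, J b) ∈ B := by
    intro a b hab
    have h1 := hR.mem (J (b - (v : ℂ) • a))
    rwa [← hJR, hR.apply hab, map_sub, map_smulₛₗ, conj_ofReal, sub_add_cancel] at h1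
  have hJA : ∀ a b, (a, b) ∈ A.graph → (J a, J b) ∈ A.graph := by
    intro a b hab
    refine hA.mem_graph_of_inner_eq_zero hB hv hψ hψ0 (hJB a b (hB.1 hab)) ?_
    have h1 : J b - (v : ℂ) • J a = J (b - (v : ℂ) • a) := by
      rw [map_sub, map_smulₛₗ, conj_ofReal]
    have h2 := mem_relKer_adjoint.1 hψ a b hab
    rw [conj_ofReal] at h2
    rw [h1, inner_involution_right hJ, hJψ, h2]
  refine isCommutingInvolution_of_map_mem hJ fun B' hB' η ω hx => ?_
  obtain ⟨α, β, hg⟩ := hA.exists_adjoint_decomposition hB hv hψ hψ0 (hB'.le_adjoint hx)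
  have hs : inner ℂ (relResolvent B v ψ) ψ = inner ℂ ψ (relResolvent B v ψ) := by
    have := inner_relResolvent_left hB.2 hv ψ ψ
    rwa [conj_ofReal] at this
  have hJp : J (relResolvent B v ψ) = relResolvent B v ψ := by rw [hJR, hJψ]
  set p := relResolvent B (v : ℂ) ψ
  set q := ψ + (v : ℂ) • p with hq
  have hJq : J q = q := by rw [hq, map_add, map_smulₛₗ, conj_ofReal, hJψ, hJp]
  have hb : (α • p + β • ψ, α • q + β • (v : ℂ) • ψ) ∈ B' := by
    have h1 := sub_mem hx (hB'.1 hg)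
    rwa [Prod.mk_sub_mk, sub_sub_cancel, sub_sub_cancel] at h1
  have hform : conj α * β = conj β * α := by
    have h1 := mem_adjoint_iff_inner.1 (hB'.2.ge hb) _ _ hb
    have h2 : (inner ℂ ψ ψ : ℂ) ≠ 0 := inner_self_ne_zero.2 hψ0
    rw [hq] at h1
    simp only [inner_add_left, inner_add_right, inner_smul_left, inner_smul_right, hs,
      conj_ofReal, smul_add] at h1
    refine mul_right_cancel₀ h2 ?_
    linear_combination h1
  have hb' : (conj α • p + conj β • ψ, conj α • q + conj β • (v : ℂ) • ψ) ∈ B' := by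
    rcases eq_or_ne α 0 with hα | hα
    · rcases eq_or_ne β 0 with hβ | hβ
      · simp only [hα, hβ, map_zero, zero_smul, add_zero]
        exact B'.zero_mem
      · have h1 := B'.smul_mem (conj β / β) hb
        simpa [hα, smul_smul, div_mul_cancel₀ _ hβ] using h1
    · have h1 := B'.smul_mem (conj α / α) hb
      have h2 : conj α / α * β = conj β := by
        field_simp
        linear_combination hform
      rwa [Prod.smul_mk, smul_add, smul_add, smul_smul, smul_smul, smul_smul,
        smul_smul _ β, h2, div_mul_cancel₀ _ hα] at h1
  have h1 := add_mem (hB'.1 (hJA _ _ hg)) hb'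
  convert h1 using 1
  refine Prod.ext ?_ ?_
  · change J η = J (η - (α • p + β • ψ)) + (conj α • p + conj β • ψ)
    rw [map_sub, map_add, map_smulₛₗ, map_smulₛₗ, hJp, hJψ, sub_add_cancel]
  · change J ω = J (ω - (α • q + β • (v : ℂ) • ψ)) + (conj α • q + conj β • (v : ℂ) • ψ)
    rw [map_sub, map_add, map_smulₛₗ, map_smulₛₗ, map_smulₛₗ, conj_ofReal, hJq, hJψ,
      sub_add_cancel]

theorem IsCanonicalExtension.inner_deficiencyTransfer (hB : IsCanonicalExtension A B) {v : ℝ}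
    (ψ : H) {z w : ℂ} (hz : z ∉ relSpectrum B) (hw : w ∉ relSpectrum B) :
    inner ℂ (deficiencyTransfer B v z ψ) (deficiencyTransfer B v w ψ) =
      inner ℂ (deficiencyTransfer B v (conj w) ψ) (deficiencyTransfer B v (conj z) ψ) := by
  have hz' := conj_notMem_relSpectrum hB.2 hz
  have hw' := conj_notMem_relSpectrum hB.2 hw
  have e1 := fun x y => inner_relResolvent_left hB.2 hz x y
  have e2 := fun x y => inner_relResolvent_left hB.2 hw' x y
  rw [conj_conj] at e2
  have e3 := relResolvent_comm hz' hw ψ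
  simp only [deficiencyTransfer, inner_add_left, inner_add_right, inner_smul_left,
    inner_smul_right, e1, e2, e3, map_sub, conj_conj, conj_ofReal]
  ring

/-- An antilinear isometry is determined by prescribing its values on a family with dense span,
provided that inner products are carried to their conjugates. -/
theorem exists_antilinear_isometry {ι : Type*} {x y : ι → H}
    (hx : (Submodule.span ℂ (Set.range x))ᗮ = ⊥)
    (hxy : ∀ i j, inner ℂ (y i) (y j) = inner ℂ (x j) (x i)) :
    ∃ J : H →ₗᵢ⋆[ℂ] H, ∀ i, J (x i) = y i := by
  let e : (ι →₀ ℂ) →ₗ[ℂ] H := Finsupp.linearCombination ℂ x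
  let f : (ι →₀ ℂ) →ₛₗ[starRingEnd ℂ] H :=
    { toFun := fun l => l.sum fun i c => conj c • y i
      map_add' := fun l m => Finsupp.sum_add_index' (by simp) (by simp [add_smul])
      map_smul' := fun c l => by
        rw [Finsupp.sum_smul_index' (by simp), Finsupp.smul_sum]
        simp [mul_smul] }
  have he : DenseRange e := by
    have h1 := Submodule.topologicalClosure_eq_top_iff.2 hx
    rw [← Finsupp.range_linearCombination, ← Submodule.dense_iff_topologicalClosure_eq_top] at h1
    exact h1
  have hnorm : ∀ l, ‖f l‖ = ‖e l‖ := by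
    intro l
    have h1 : inner ℂ (f l) (f l) = inner ℂ (e l) (e l) := by
      change inner ℂ (l.sum fun i c => conj c • y i) (l.sum fun i c => conj c • y i) =
        inner ℂ (l.sum fun i c => c • x i) (l.sum fun i c => c • x i)
      simp only [Finsupp.sum, sum_inner, inner_sum, inner_smul_left, inner_smul_right, conj_conj,
        hxy, Finset.mul_sum]
      rw [Finset.sum_comm]
      exact Finset.sum_congr rfl fun i _ => Finset.sum_congr rfl fun j _ => by ring
    have h2 : ((‖f l‖ ^ 2 : ℝ) : ℂ) = ((‖e l‖ ^ 2 : ℝ) : ℂ) := by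
      rw [inner_self_eq_norm_sq_to_K, inner_self_eq_norm_sq_to_K] at h1
      exact_mod_cast h1
    exact (sq_eq_sq₀ (norm_nonneg _) (norm_nonneg _)).1 (ofReal_injective h2)
  have hfe : ∀ l, f.extendOfNorm e (e l) = f l :=
    LinearMap.extendOfNorm_eq he ⟨1, fun l => by rw [one_mul, hnorm]⟩
  refine ⟨⟨(f.extendOfNorm e : H →ₛₗ[starRingEnd ℂ] H), fun u => ?_⟩, fun i => ?_⟩
  · refine he.induction_on (p := fun u => ‖f.extendOfNorm e u‖ = ‖u‖) u
      (isClosed_eq (by fun_prop) (by fun_prop)) fun l => ?_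
    rw [hfe, hnorm]
  · change f.extendOfNorm e (x i) = y i
    have h1 : e (Finsupp.single i 1) = x i := by simp [e]
    rw [← h1, hfe]
    change (Finsupp.single i (1 : ℂ)).sum (fun i c => conj c • y i) = y i
    simp

theorem IsClassS.span_deficiencyTransfer_orthogonal (hA : IsClassS A)
    (hB : IsCanonicalExtension A B) {v : ℝ} (hv : (v : ℂ) ∉ relSpectrum B) {ψ : H}
    (hψ : ψ ∈ relKer A.graph.adjoint (v : ℂ)) (hψ0 : ψ ≠ 0) :
    (Submodule.span ℂ
      (Set.range fun z : {z : ℂ // z.im ≠ 0} => deficiencyTransfer B v z ψ))ᗮ = ⊥ := by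
  rw [Submodule.eq_bot_iff]
  intro φ hφ
  refine hA.eq_zero_of_forall_inner_eq_zero hB fun z hz η hη => ?_
  have hz' := notMem_relSpectrum_of_im_ne_zero hB.2 hz
  obtain ⟨c, hc⟩ := (finrank_eq_one_iff_of_nonzero'
    (⟨_, hB.deficiencyTransfer_mem hz' hψ⟩ : relKer A.graph.adjoint z)
    (fun h => deficiencyTransfer_ne_zero hv hz' hψ0 (congrArg Subtype.val h))).1
    (hA.finrank_relKer_adjoint hB hz') ⟨η, hη⟩
  have hc' : c • deficiencyTransfer B v z ψ = η := congrArg Subtype.val hc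
  rw [← hc', inner_smul_left, (Submodule.mem_orthogonal _ _).1 hφ _
    (Submodule.subset_span ⟨⟨z, hz⟩, rfl⟩), mul_zero]

/-- A continuous linear or antilinear map is determined by its values on the deficiency vectors at
nonreal points. -/
theorem IsClassS.eq_of_eq_deficiencyTransfer (hA : IsClassS A) (hB : IsCanonicalExtension A B)
    {v : ℝ} (hv : (v : ℂ) ∉ relSpectrum B) {ψ : H} (hψ : ψ ∈ relKer A.graph.adjoint (v : ℂ))
    (hψ0 : ψ ≠ 0) {σ : ℂ →+* ℂ} {f g : H →SL[σ] H}
    (h : ∀ z : ℂ, z.im ≠ 0 → f (deficiencyTransfer B v z ψ) = g (deficiencyTransfer B v z ψ))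
    (x : H) : f x = g x := by
  refine DFunLike.congr_fun (ContinuousLinearMap.ext_on
    (Submodule.dense_iff_topologicalClosure_eq_top.2 (Submodule.topologicalClosure_eq_top_iff.2
      (hA.span_deficiencyTransfer_orthogonal hB hv hψ hψ0))) ?_) x
  rintro _ ⟨z, rfl⟩
  exact h z z.2

theorem IsClassS.exists_antilinear_isometry_deficiencyTransfer (hA : IsClassS A)
    (hB : IsCanonicalExtension A B) {v : ℝ} (hv : (v : ℂ) ∉ relSpectrum B) {ψ : H}
    (hψ : ψ ∈ relKer A.graph.adjoint (v : ℂ)) (hψ0 : ψ ≠ 0) :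
    ∃ J : H →ₗᵢ⋆[ℂ] H, ∀ z, z ∉ relSpectrum B →
      J (deficiencyTransfer B v z ψ) = deficiencyTransfer B v (conj z) ψ := by
  let x : {z : ℂ // z ∉ relSpectrum B} → H := fun z => deficiencyTransfer B v z ψ
  let y : {z : ℂ // z ∉ relSpectrum B} → H := fun z => deficiencyTransfer B v (conj (z : ℂ)) ψ
  have hx : (Submodule.span ℂ (Set.range x))ᗮ = ⊥ := by
    rw [eq_bot_iff, ← hA.span_deficiencyTransfer_orthogonal hB hv hψ hψ0]
    refine Submodule.orthogonal_le (Submodule.span_mono ?_)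
    rintro _ ⟨z, rfl⟩
    exact ⟨⟨z, notMem_relSpectrum_of_im_ne_zero hB.2 z.2⟩, rfl⟩
  have hxy : ∀ z w, inner ℂ (y z) (y w) = inner ℂ (x w) (x z) := by
    intro z w
    have h := hB.inner_deficiencyTransfer (v := v) ψ (conj_notMem_relSpectrum hB.2 z.2)
      (conj_notMem_relSpectrum hB.2 w.2)
    rwa [conj_conj, conj_conj] at h
  obtain ⟨J, hJ⟩ := exists_antilinear_isometry hx hxy
  exact ⟨J, fun z hz => hJ ⟨z, hz⟩⟩

/-- The involution that exchanges `[I + (z - v)(B - zI)⁻¹] ψ` and `[I + (z̄ - v)(B - z̄I)⁻¹] ψ`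
commutes with all canonical selfadjoint extensions. -/
theorem IsClassS.exists_isCommutingInvolution (hA : IsClassS A) :
    ∃ J, IsCommutingInvolution A J := by
  obtain ⟨B, -, hB, -, -⟩ := hA.exists_extensions_inf_le
  obtain ⟨v, hv⟩ := hA.exists_real_notMem_relSpectrum hB
  obtain ⟨⟨ψ, hψ⟩, h0, -⟩ := finrank_eq_one_iff'.1 (hA.finrank_relKer_adjoint hB hv)
  have hψ0 : ψ ≠ 0 := fun h => h0 (Subtype.ext h)
  obtain ⟨J, hJ⟩ := hA.exists_antilinear_isometry_deficiencyTransfer hB hv hψ hψ0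
  have hJψ : J ψ = ψ := by
    have := hJ v hv
    rwa [conj_ofReal, deficiencyTransfer_self] at this
  let Jc : H →L⋆[ℂ] H := J.toContinuousLinearMap
  have hJJ : ∀ x, J (J x) = x := by
    let f : H →L[ℂ] H := Jc.comp Jc
    let g : H →L[ℂ] H := ContinuousLinearMap.id ℂ H
    suffices h : ∀ z : ℂ, z.im ≠ 0 →
        f (deficiencyTransfer B v z ψ) = g (deficiencyTransfer B v z ψ) from
      fun x => hA.eq_of_eq_deficiencyTransfer hB hv hψ hψ0 h x
    intro z hz
    have hz' := notMem_relSpectrum_of_im_ne_zero hB.2 hz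
    change J (J (deficiencyTransfer B v z ψ)) = deficiencyTransfer B v z ψ
    rw [hJ _ hz', hJ _ (conj_notMem_relSpectrum hB.2 hz'), conj_conj]
  have hJR : ∀ x, J (relResolvent B v x) = relResolvent B v (J x) := by
    let f : H →L⋆[ℂ] H := Jc.comp (relResolvent B v)
    let g : H →L⋆[ℂ] H := (relResolvent B v).comp Jc
    suffices h : ∀ z : ℂ, z.im ≠ 0 →
        f (deficiencyTransfer B v z ψ) = g (deficiencyTransfer B v z ψ) from
      fun x => hA.eq_of_eq_deficiencyTransfer hB hv hψ hψ0 h x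
    intro z hz
    have hz' := notMem_relSpectrum_of_im_ne_zero hB.2 hz
    have hz'' := conj_notMem_relSpectrum hB.2 hz'
    change J (relResolvent B v (deficiencyTransfer B v z ψ)) =
      relResolvent B v (J (deficiencyTransfer B v z ψ))
    rw [hJ _ hz', relResolvent_deficiencyTransfer hv hz', relResolvent_deficiencyTransfer hv hz'']
    have h2 := hJ _ hz'
    rw [deficiencyTransfer, deficiencyTransfer, map_add, map_smulₛₗ, hJψ, map_sub,
      conj_ofReal] at h2
    refine smul_right_injective H ?_ (add_left_cancel h2)
    rw [sub_ne_zero]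
    intro h3
    apply hz
    rw [← conj_conj z, h3, conj_ofReal, ofReal_im]
  exact ⟨J, hA.isCommutingInvolution hB hv hψ hψ0 hJJ hJψ hJR⟩

end Involutions

/-! ### The model function -/

section ModelFunction

variable {H : Type*} [NormedAddCommGroup H] [InnerProductSpace ℂ H]
  {A : H →ₗ.[ℂ] H} {B : Submodule ℂ (H × H)} {J : H →ₗᵢ⋆[ℂ] H} {v : ℝ} {ψ : H} {h : ℂ → ℂ}
  {ξ : ℂ → H}

theorem dense_im_ne_zero : Dense {z : ℂ | z.im ≠ 0} := by
  intro x
  by_cases hx : x.im = 0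
  · have h1 : Tendsto (fun t : ℝ => x + t * I) (𝓝[≠] 0) (𝓝 x) := by
      have : Continuous fun t : ℝ => x + t * I := by fun_prop
      exact (this.tendsto' 0 _ (by simp)).mono_left nhdsWithin_le_nhds
    refine mem_closure_of_tendsto h1 ?_
    filter_upwards [self_mem_nhdsWithin] with t ht
    simpa [hx] using ht
  · exact subset_closure hx

theorem forall_of_forall_im_ne_zero {p : ℂ → Prop} (hp : IsClosed {z | p z})
    (h : ∀ z : ℂ, z.im ≠ 0 → p z) (z : ℂ) : p z :=
  (hp.closure_subset_iff.2 h) (dense_im_ne_zero z)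

variable [CompleteSpace H]

theorem IsClassS.exists_isModelData (hA : IsClassS A) (hJ : IsCommutingInvolution A J)
    (hB : IsCanonicalExtension A B) : ∃ v ψ h, IsModelData A J B v ψ h := by
  obtain ⟨v, hv⟩ := hA.exists_real_notMem_relSpectrum hB
  have hN : ∀ η ∈ relKer A.graph.adjoint (v : ℂ), J η ∈ relKer A.graph.adjoint (v : ℂ) := by
    intro η hη
    have h1 := map_mem_relKer_adjoint hJ.involutive (hJ.map_mem_graph hA) hη
    rwa [conj_ofReal] at h1
  have hN0 : relKer A.graph.adjoint (v : ℂ) ≠ ⊥ := by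
    intro h0
    have h1 := hA.finrank_relKer_adjoint hB hv
    rw [h0, finrank_bot] at h1
    exact zero_ne_one h1
  obtain ⟨ψ, hψ, hψ0, hψJ⟩ := exists_real_vector hJ.involutive hN hN0
  obtain ⟨h, hd, hr, hz, hs⟩ := exists_entire_simple_zeros
    (hA.eventually_notMem_relSpectrum hB) (fun z => conj_eq_of_mem_relSpectrum hB.2) hv
  exact ⟨v, ψ, h, hB, hv, hψ, hψ0, hψJ, hd, hr, hz, hs⟩

/-- At the points of the spectrum of `B` the singularities of `h(z) [I + (z - v)(B - zI)⁻¹] ψ` are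
removable: the zero of `h` compensates the simple pole of the resolvent. -/
theorem IsClassS.exists_isModelFunction (hA : IsClassS A) (hD : IsModelData A J B v ψ h) :
    ∃ ξ, IsModelFunction B v ψ h ξ := by
  classical
  set g : ℂ → H := fun z => h z • deficiencyTransfer B v z ψ with hg
  have hgd : ∀ z, z ∉ relSpectrum B → DifferentiableAt ℂ g z := fun z hz =>
    (hD.entire z).smul (differentiableAt_deficiencyTransfer hz ψ)
  set ξ : ℂ → H := fun z => if z ∈ relSpectrum B then limUnder (𝓝[≠] z) g else g z with hξ
  have hξg : ∀ z, z ∉ relSpectrum B → ξ z = g z := fun z hz => if_neg hz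
  refine ⟨ξ, fun z => ?_, hξg⟩
  by_cases hz : z ∈ relSpectrum B
  · obtain ⟨δ, hδ, hbd⟩ := hA.exists_norm_relResolvent_le hD.extension hz
    obtain ⟨C, hC⟩ := (hD.entire z).isBigO_sub.bound
    obtain ⟨ε, hε, hCε⟩ := Metric.eventually_nhds_iff.1 hC
    set r := min (min δ ε) 1 with hr
    have hr0 : 0 < r := lt_min (lt_min hδ hε) one_pos
    have hdiff : DifferentiableOn ℂ (Function.update g z (limUnder (𝓝[≠] z) g))
        (Metric.ball z r) := by
      refine differentiableOn_update_limUnder_of_bddAbove (Metric.ball_mem_nhds z hr0)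
        (fun w hw => ?_) ⟨C * (‖ψ‖ + (1 + ‖z - v‖) * ‖ψ‖), ?_⟩
      · have hw1 : ‖w - z‖ < r := by simpa [dist_eq_norm] using hw.1
        exact (hgd w (hbd w hw.2 (hw1.trans_le ((min_le_left _ _).trans
          (min_le_left _ _)))).1).differentiableWithinAt
      · rintro _ ⟨w, hw, rfl⟩
        have hw1 : ‖w - z‖ < r := by simpa [dist_eq_norm] using hw.1
        have hwδ : ‖w - z‖ < δ := hw1.trans_le ((min_le_left _ _).trans (min_le_left _ _))
        have hwε : dist w z < ε := by
          rw [dist_eq_norm]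
          exact hw1.trans_le ((min_le_left _ _).trans (min_le_right _ _))
        have hw1' : ‖w - z‖ < 1 := hw1.trans_le (min_le_right _ _)
        have hpos : 0 < ‖w - z‖ := norm_pos_iff.2 (sub_ne_zero.2 hw.2)
        have h1 := hCε hwε
        rw [(hD.zeros z).2 hz, sub_zero] at h1
        have h2 := (hbd w hw.2 hwδ).2
        have h3 : ‖w - v‖ ≤ 1 + ‖z - v‖ := by
          have := norm_add_le (w - z) (z - v)
          rw [sub_add_sub_cancel] at this
          linarith
        have h4 : ‖relResolvent B w ψ‖ ≤ ‖w - z‖⁻¹ * ‖ψ‖ :=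
          ((relResolvent B w).le_opNorm ψ).trans (by gcongr)
        have hC0 : 0 ≤ C := by
          have := (norm_nonneg _).trans h1
          exact nonneg_of_mul_nonneg_left this hpos
        calc ‖g w‖ = ‖h w‖ * ‖ψ + (w - v) • relResolvent B w ψ‖ := norm_smul _ _
          _ ≤ C * ‖w - z‖ * (‖ψ‖ + (1 + ‖z - v‖) * (‖w - z‖⁻¹ * ‖ψ‖)) := by
              gcongr
              refine (norm_add_le _ _).trans ?_
              rw [norm_smul]
              gcongr
          _ = C * (‖w - z‖ * ‖ψ‖ + (1 + ‖z - v‖) * ‖ψ‖) := by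
              field_simp
          _ ≤ C * (‖ψ‖ + (1 + ‖z - v‖) * ‖ψ‖) := by
              gcongr
              exact mul_le_of_le_one_left (norm_nonneg _) hw1'.le
    refine (hdiff.differentiableAt (Metric.ball_mem_nhds z hr0)).congr_of_eventuallyEq ?_
    filter_upwards [Metric.ball_mem_nhds z hr0] with w hw
    rcases eq_or_ne w z with rfl | hwz
    · rw [Function.update_self]
      exact if_pos hz
    · rw [Function.update_of_ne hwz]
      have hw1 : ‖w - z‖ < r := by simpa [dist_eq_norm] using hw
      exact hξg w (hbd w hwz (hw1.trans_le ((min_le_left _ _).trans (min_le_left _ _)))).1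
  · refine (hgd z hz).congr_of_eventuallyEq ?_
    filter_upwards [(isOpen_compl_relSpectrum B).mem_nhds hz] with w hw using hξg w hw

theorem IsModelFunction.eq {ξ' : ℂ → H} (hB : B.adjoint = B) (hξ : IsModelFunction B v ψ h ξ)
    (hξ' : IsModelFunction B v ψ h ξ') : ξ = ξ' := by
  funext z
  refine forall_of_forall_im_ne_zero (p := fun z => ξ z = ξ' z)
    (isClosed_eq hξ.entire.continuous hξ'.entire.continuous) (fun z hz => ?_) z
  have hz' := notMem_relSpectrum_of_im_ne_zero hB hz
  rw [hξ.formula z hz', hξ'.formula z hz']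

/-- At a point `x₀` of the spectrum of `B`, the component of `ξ` along an eigenvector `u` is
determined by `(x₀ - z) ⟨u, ξ(z)⟩ = h(z) (x₀ - v) ⟨u, ψ⟩`. It does not vanish at `x₀` since the zero
of `h` is simple and `⟨u, ψ⟩ ≠ 0`. -/
theorem IsClassS.modelFunction_ne_zero (hA : IsClassS A) (hD : IsModelData A J B v ψ h)
    (hξ : IsModelFunction B v ψ h ξ) (z : ℂ) : ξ z ≠ 0 := by
  have hB := hD.extension
  by_cases hz : z ∈ relSpectrum B
  · obtain ⟨u, hu, hu0⟩ := hA.exists_eigenvector hB hz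
    have hzr := conj_eq_of_mem_relSpectrum hB.2 hz
    have hzv : z - v ≠ 0 := sub_ne_zero.2 fun h0 => hD.point (h0 ▸ hz)
    have huψ : (inner ℂ u ψ : ℂ) ≠ 0 := by
      intro h0
      have h1 := hA.mem_graph_of_inner_eq_zero hB hD.point hD.mem_ker hD.ne_zero
        (mem_relKer.1 hu) (by
          rw [← sub_smul, inner_smul_right, inner_eq_zero_symm.1 h0, mul_zero])
      rw [← mem_relKer, hA.relKer_graph] at h1
      exact hu0 h1
    have hF : Differentiable ℂ fun w => inner ℂ u (ξ w) :=
      (innerSL ℂ u).differentiable.comp hξ.entire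
    have hid : ∀ w, (z - w) * inner ℂ u (ξ w) = h w * ((z - v) * inner ℂ u ψ) := by
      refine forall_of_forall_im_ne_zero (isClosed_eq ?_ ?_) fun w hw => ?_
      · exact (continuous_const.sub continuous_id).mul hF.continuous
      · exact hD.entire.continuous.mul continuous_const
      · have hw' := notMem_relSpectrum_of_im_ne_zero hB.2 hw
        have hw'' := conj_notMem_relSpectrum hB.2 hw'
        have h1 := (isResolventAt_relResolvent hw'').apply (mem_relKer.1 hu)
        rw [← sub_smul, map_smul] at h1
        have h2 := inner_relResolvent_left hB.2 hw'' u ψ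
        rw [conj_conj] at h2
        have h3 : (z - w) * inner ℂ (relResolvent B (conj w) u) ψ = inner ℂ u ψ := by
          conv_rhs => rw [← h1, inner_smul_left, map_sub, hzr, conj_conj]
        rw [hξ.formula w hw', inner_smul_right, inner_add_right, inner_smul_right, ← h2]
        linear_combination (h w * (w - v)) * h3
    intro h0
    have h1 : HasDerivAt (fun w => (z - w) * inner ℂ u (ξ w)) 0 z := by
      have h2 := ((hasDerivAt_id' z).const_sub z).mul (hF z).hasDerivAt
      rw [h0, inner_zero_right, mul_zero, sub_self, zero_mul, add_zero] at h2
      exact h2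
    have h2 : HasDerivAt (fun w => (z - w) * inner ℂ u (ξ w))
        (deriv h z * ((z - v) * inner ℂ u ψ)) z := by
      rw [funext hid]
      exact (hD.entire z).hasDerivAt.mul_const _
    exact mul_ne_zero (hD.simple_zeros z ((hD.zeros z).2 hz)) (mul_ne_zero hzv huψ)
      (h2.unique h1)
  · rw [hξ.formula z hz]
    exact smul_ne_zero (fun h0 => hz ((hD.zeros z).1 h0))
      (deficiencyTransfer_ne_zero hD.point hz hD.ne_zero)

theorem IsClassS.isKernelFunction (hA : IsClassS A) (hJ : IsCommutingInvolution A J)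
    (hD : IsModelData A J B v ψ h) (hξ : IsModelFunction B v ψ h ξ) : IsKernelFunction A J ξ := by
  have hB := hD.extension
  have hc := hξ.entire.continuous
  refine ⟨hξ.entire, hA.modelFunction_ne_zero hD hξ, fun z => ?_, fun z => ?_⟩
  · rw [mem_relKer_adjoint]
    intro a b hab
    refine forall_of_forall_im_ne_zero (p := fun z => inner ℂ (b - conj z • a) (ξ z) = 0)
      (isClosed_eq (Continuous.inner (by fun_prop) hc) continuous_const) (fun z hz => ?_) z
    have hz' := notMem_relSpectrum_of_im_ne_zero hB.2 hz
    rw [hξ.formula z hz']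
    exact mem_relKer_adjoint.1 (Submodule.smul_mem _ _ (hB.deficiencyTransfer_mem hz' hD.mem_ker))
      a b hab
  · refine forall_of_forall_im_ne_zero (p := fun z => J (ξ z) = ξ (conj z))
      (isClosed_eq (J.continuous.comp hc) (hc.comp continuous_conj)) (fun z hz => ?_) z
    have hz' := notMem_relSpectrum_of_im_ne_zero hB.2 hz
    rw [hξ.formula z hz', hξ.formula _ (conj_notMem_relSpectrum hB.2 hz'), map_smulₛₗ, map_add,
      map_smulₛₗ, hJ.commutes B hB z hz, hD.real_vector, hD.real_entire, map_sub, conj_ofReal]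

end ModelFunction

/-! ### The de Branges space of a kernel function -/

section ModelSpace

variable {H : Type*} [NormedAddCommGroup H] [InnerProductSpace ℂ H]
  {A : H →ₗ.[ℂ] H} {J : H →ₗᵢ⋆[ℂ] H} {ξ : ℂ → H}

theorem modelMap_apply (ξ : ℂ → H) (φ : H) (z : ℂ) :
    modelMap ξ φ z = inner ℂ (ξ (conj z)) φ := rfl

theorem IsKernelFunction.modelMap_of_mem_graph (hξ : IsKernelFunction A J ξ) {a b : H}
    (hab : (a, b) ∈ A.graph) (z : ℂ) : modelMap ξ b z = z * modelMap ξ a z := by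
  have h := mem_relKer_adjoint.1 (hξ.mem_ker (conj z)) a b hab
  rw [conj_conj, inner_eq_zero_symm, inner_sub_right, inner_smul_right, sub_eq_zero] at h
  exact h

theorem IsKernelFunction.differentiable_modelMap (hξ : IsKernelFunction A J ξ)
    (hJ : ∀ x, J (J x) = x) (φ : H) : Differentiable ℂ (modelMap ξ φ) := by
  have h : modelMap ξ φ = fun z => inner ℂ (J φ) (ξ z) := by
    funext z
    rw [modelMap_apply, ← hξ.real, ← inner_antilinear_isometry J, hJ]
  rw [h]
  exact (innerSL ℂ (J φ)).differentiable.comp hξ.entire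

theorem IsKernelFunction.modelMap_involution (hξ : IsKernelFunction A J ξ) (φ : H) (z : ℂ) :
    modelMap ξ (J φ) z = conj (modelMap ξ φ (conj z)) := by
  rw [modelMap_apply, modelMap_apply, ← hξ.real, inner_antilinear_isometry, conj_conj,
    inner_conj_symm]

/-- For a symmetric operator, `‖(A - wI) a‖ = ‖(A - w̄I) a‖`. -/
theorem IsClassS.norm_sub_conj_smul (hA : IsClassS A) {a b : H} (hab : (a, b) ∈ A.graph) (w : ℂ) :
    ‖b - conj w • a‖ = ‖b - w • a‖ := by
  have hs : inner ℂ b a = inner ℂ a b :=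
    mem_adjoint_iff_inner.1 (hA.graph_le_adjoint hab) a b hab
  have h1 : inner ℂ (b - conj w • a) (b - conj w • a) = inner ℂ (b - w • a) (b - w • a) := by
    simp only [inner_sub_left, inner_sub_right, inner_smul_left, inner_smul_right, conj_conj, hs]
    ring
  rw [norm_eq_sqrt_re_inner (𝕜 := ℂ), h1, ← norm_eq_sqrt_re_inner]

variable [CompleteSpace H]

theorem IsKernelFunction.mem_shiftRange_of_modelMap_eq_zero (hA : IsClassS A)
    (hξ : IsKernelFunction A J ξ) {z : ℂ} (hz : z.im ≠ 0) {φ : H} (h : modelMap ξ φ z = 0) :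
    φ ∈ shiftRange A.graph z := by
  obtain ⟨B, -, hB, -, -⟩ := hA.exists_extensions_inf_le
  exact hA.mem_shiftRange_of_inner_eq_zero
    (hA.finrank_relKer_adjoint hB (notMem_relSpectrum_of_im_ne_zero hB.2 (by simpa using hz)))
    (hξ.mem_ker _) (hξ.zero_free _) h

theorem IsKernelFunction.eq_zero_of_modelMap (hA : IsClassS A) (hξ : IsKernelFunction A J ξ)
    {φ : H} (h : ∀ z, modelMap ξ φ z = 0) : φ = 0 := by
  obtain ⟨B, -, hB, -, -⟩ := hA.exists_extensions_inf_le
  refine hA.eq_zero_of_forall_inner_eq_zero hB fun z hz η hη => ?_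
  have h1 := hξ.mem_shiftRange_of_modelMap_eq_zero hA (z := conj z) (by simpa using hz) (h _)
  rw [hA.shiftRange_eq, conj_conj, Submodule.mem_orthogonal] at h1
  exact h1 η hη

theorem IsKernelFunction.injective_modelMap (hA : IsClassS A) (hξ : IsKernelFunction A J ξ) :
    Function.Injective (modelMap ξ) :=
  (injective_iff_map_eq_zero _).2 fun _ h => hξ.eq_zero_of_modelMap hA (congrFun h)

/-- A pair `(x, y)` belongs to the graph of `A` as soon as `Φy` is `z` times `Φx`: with `a` such
that `y - ix = (A - iI) a`, the vector `x - a` is annihilated by `Φ`. -/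
theorem IsKernelFunction.mem_graph_iff (hA : IsClassS A) (hJ : ∀ x, J (J x) = x)
    (hξ : IsKernelFunction A J ξ) {x y : H} :
    (x, y) ∈ A.graph ↔ ∀ z, modelMap ξ y z = z * modelMap ξ x z := by
  refine ⟨fun h => hξ.modelMap_of_mem_graph h, fun h => ?_⟩
  have h1 : modelMap ξ (y - I • x) I = 0 := by
    rw [map_sub, map_smul, Pi.sub_apply, Pi.smul_apply, smul_eq_mul, h, sub_self]
  obtain ⟨a, b, hab, hu⟩ :=
    mem_shiftRange.1 (hξ.mem_shiftRange_of_modelMap_eq_zero hA (by simp) h1)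
  have h2 : ∀ z, (z - I) * modelMap ξ (x - a) z = 0 := by
    intro z
    have h3 := congrFun (congrArg (modelMap ξ) hu) z
    simp only [map_sub, map_smul, Pi.sub_apply, Pi.smul_apply, smul_eq_mul, h,
      hξ.modelMap_of_mem_graph hab] at h3 ⊢
    linear_combination -h3
  have h4 : x - a = 0 := by
    refine hξ.eq_zero_of_modelMap hA fun z => ?_
    have hc := (hξ.differentiable_modelMap hJ (x - a)).continuous
    have hd : Dense {z : ℂ | z ≠ I} := dense_compl_singleton I
    refine (isClosed_eq hc continuous_const).closure_subset_iff.2 ?_ (hd z)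
    intro w hw
    exact (mul_eq_zero.1 (h2 w)).resolve_left (sub_ne_zero.2 hw)
  have h5 : x = a := sub_eq_zero.1 h4
  subst h5
  rwa [sub_left_inj.1 hu] at hab

open FunctionHilbertSpace

theorem imageUnitary_symm_fn {Φ : H →ₗ[ℂ] (ℂ → ℂ)} (hΦ : Function.Injective Φ)
    (f : (imageSpace Φ hΦ).Elem) : Φ ((imageUnitary Φ hΦ).symm f) = f.fn := by
  rw [← imageUnitary_fn Φ hΦ, LinearIsometryEquiv.apply_symm_apply]

theorem Elem.ext_fn {𝓑 : FunctionHilbertSpace} {f g : 𝓑.Elem} (h : f.fn = g.fn) : f = g :=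
  Subtype.ext h

theorem IsKernelFunction.isDeBranges (hA : IsClassS A) (hJ : IsCommutingInvolution A J)
    (hξ : IsKernelFunction A J ξ) (hΦ : Function.Injective (modelMap ξ)) :
    (imageSpace (modelMap ξ) hΦ).IsDeBranges where
  nontrivial := by
    have : Nontrivial H := ⟨⟨ξ 0, 0, hξ.zero_free 0⟩⟩
    exact (imageUnitary (modelMap ξ) hΦ).injective.nontrivial
  entire f := by
    rw [← imageUnitary_symm_fn hΦ f]
    exact hξ.differentiable_modelMap hJ.involutive _
  continuous_eval w _ := by
    simp_rw [← imageUnitary_symm_fn hΦ, modelMap_apply]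
    exact continuous_const.inner (imageUnitary (modelMap ξ) hΦ).symm.continuous
  blaschke f w hw hf := by
    rw [← imageUnitary_symm_fn hΦ f] at hf
    obtain ⟨a, b, hab, hu⟩ := mem_shiftRange.1 (hξ.mem_shiftRange_of_modelMap_eq_zero hA hw hf)
    -- the Blaschke factor turns `Φ((A - wI) a)` into `Φ((A - w̄I) a)`
    refine ⟨imageUnitary (modelMap ξ) hΦ (b - conj w • a), fun z hz => ?_, ?_⟩
    · rw [imageUnitary_fn, ← imageUnitary_symm_fn hΦ f, ← hu]
      simp only [map_sub, map_smul, Pi.sub_apply, Pi.smul_apply, smul_eq_mul,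
        hξ.modelMap_of_mem_graph hab]
      field_simp [sub_ne_zero.2 hz]
    · rw [LinearIsometryEquiv.norm_map, hA.norm_sub_conj_smul hab, hu,
        LinearIsometryEquiv.norm_map]
  sharp f := by
    refine ⟨imageUnitary (modelMap ξ) hΦ (J ((imageUnitary (modelMap ξ) hΦ).symm f)),
      fun z => ?_, ?_⟩
    · rw [imageUnitary_fn, hξ.modelMap_involution, imageUnitary_symm_fn]
    · rw [LinearIsometryEquiv.norm_map, J.norm_map, LinearIsometryEquiv.norm_map]

theorem exists_reproducing_kernel (hΦ : Function.Injective (modelMap ξ)) (w : ℂ) :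
    ∃ k : (imageSpace (modelMap ξ) hΦ).Elem,
      (∀ z, k.fn z = inner ℂ (ξ (conj z)) (ξ (conj w))) ∧
      ∀ f : (imageSpace (modelMap ξ) hΦ).Elem, inner ℂ k f = f.fn w := by
  refine ⟨imageUnitary (modelMap ξ) hΦ (ξ (conj w)), fun z => rfl, fun f => ?_⟩
  obtain ⟨φ, rfl⟩ := (imageUnitary (modelMap ξ) hΦ).surjective f
  rw [LinearIsometryEquiv.inner_map_map, imageUnitary_fn, modelMap_apply]

theorem mem_graph_mulOperator {𝓑 : FunctionHilbertSpace} {f g : 𝓑.Elem} :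
    (f, g) ∈ 𝓑.mulOperator.graph ↔ ∀ z, g.fn z = z * f.fn z := by
  rw [LinearPMap.mem_graph_iff]
  constructor
  · rintro ⟨y, rfl, rfl⟩ z
    rfl
  · intro h
    have hf : (fun z => z * f.fn z) ∈ 𝓑.carrier := by
      rw [← funext h]
      exact Subtype.property (p := (· ∈ 𝓑.carrier)) g
    exact ⟨⟨f, hf⟩, rfl, Elem.ext_fn (funext fun z => (h z).symm)⟩

theorem IsKernelFunction.intertwines (hA : IsClassS A) (hJ : IsCommutingInvolution A J)
    (hξ : IsKernelFunction A J ξ) (hΦ : Function.Injective (modelMap ξ)) :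
    Intertwines (imageUnitary (modelMap ξ) hΦ) A (imageSpace (modelMap ξ) hΦ).mulOperator := by
  intro x y
  rw [hξ.mem_graph_iff hA hJ.involutive, mem_graph_mulOperator]
  simp only [imageUnitary_fn]

end ModelSpace

end DeBrangesModel

theorem mainTheorem7 {H : Type*} [NormedAddCommGroup H] [InnerProductSpace ℂ H] [CompleteSpace H]
    (A : H →ₗ.[ℂ] H) (hA : IsClassS A) :
    -- canonical selfadjoint extensions and commuting involutions exist
    (∃ B, IsCanonicalExtension A B) ∧ (∃ J, IsCommutingInvolution A J) ∧
    -- the data `v`, `ψ`, `h` exist for every choice of the extension and of the involution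
    (∀ J B, IsCommutingInvolution A J → IsCanonicalExtension A B →
      ∃ v ψ h, IsModelData A J B v ψ h) ∧
    -- for all data the formula defines exactly one entire function, and it has the properties
    -- of a kernel function
    (∀ J B v ψ h, IsCommutingInvolution A J → IsModelData A J B v ψ h →
      (∃! ξ, IsModelFunction B v ψ h ξ) ∧
      ∀ ξ, IsModelFunction B v ψ h ξ → IsKernelFunction A J ξ) ∧
    -- the image space is a de Branges space with kernel `⟨ξ(z̄), ξ(w̄)⟩`, in which `A` becomes
    -- multiplication by the independent variable
    (∀ J ξ, IsCommutingInvolution A J → IsKernelFunction A J ξ →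
      ∃ hΦ : Function.Injective (modelMap ξ),
        (imageSpace (modelMap ξ) hΦ).IsDeBranges ∧
        (∀ w : ℂ, ∃ k : (imageSpace (modelMap ξ) hΦ).Elem,
          (∀ z, k.fn z = inner ℂ (ξ (conj z)) (ξ (conj w))) ∧
          ∀ f : (imageSpace (modelMap ξ) hΦ).Elem, inner ℂ k f = f.fn w) ∧
        Intertwines (imageUnitary (modelMap ξ) hΦ) A (imageSpace (modelMap ξ) hΦ).mulOperator) ∧
    -- hence `A` is unitarily equivalent to multiplication by `z` in a de Branges space
    (∃ (𝓑 : FunctionHilbertSpace) (U : H ≃ₗᵢ[ℂ] 𝓑.Elem),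
      𝓑.IsDeBranges ∧ Intertwines U A 𝓑.mulOperator) := by
  obtain ⟨B₀, -, hB₀, -, -⟩ := hA.exists_extensions_inf_le
  obtain ⟨J₀, hJ₀⟩ := hA.exists_isCommutingInvolution
  obtain ⟨v₀, ψ₀, h₀, hD₀⟩ := hA.exists_isModelData hJ₀ hB₀
  obtain ⟨ξ₀, hξ₀⟩ := hA.exists_isModelFunction hD₀
  have hK₀ := hA.isKernelFunction hJ₀ hD₀ hξ₀
  have hΦ₀ := hK₀.injective_modelMap hA
  refine ⟨⟨B₀, hB₀⟩, ⟨J₀, hJ₀⟩, fun J B hJ hB => hA.exists_isModelData hJ hB,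
    fun J B v ψ h hJ hD => ⟨?_, fun ξ hξ => hA.isKernelFunction hJ hD hξ⟩,
    fun J ξ hJ hξ => ⟨hξ.injective_modelMap hA, hξ.isDeBranges hA hJ _,
      exists_reproducing_kernel _, hξ.intertwines hA hJ _⟩,
    ⟨_, imageUnitary (modelMap ξ₀) hΦ₀, hK₀.isDeBranges hA hJ₀ _, hK₀.intertwines hA hJ₀ _⟩⟩
  obtain ⟨ξ, hξ⟩ := hA.exists_isModelFunction hD
  exact ⟨ξ, hξ, fun ξ' hξ' => hξ'.eq hD.extension.2 hξ⟩
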